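/- Let $L>0$ and let $L^2_{x\,dx}$ be the real Hilbert space of (classes of) measurable functions $u$ on $(0,L)$ with $\int_0^L u(x)^2\,x\,dx<\infty$, with scalar product $(u,v)=\int_0^L u(x)v(x)\,x\,dx$. Let $A_1u=-u_{xxxxx}-u_{xxx}$ (derivatives in the sense of distributions on $(0,L)$) with domain $$D(A_1)=\{u\in H^4(0,L)\cap H^2_0(0,L)\;:\;u_{xxxxx}\in L^2_{x\,dx},\ u_{xx}(L)=0\}\subset L^2_{x\,dx}.$$ Then the operator $-A_1$, that is, $u\mapsto u_{xxxxx}+u_{xxx}$ with domain $D(-A_1)=D(A_1)$, is the infinitesimal generator of a strongly continuous semigroup $(T(t))_{t\ge 0}$ of bounded linear operators on $L^2_{x\,dx}$. (This is the semigroup solving $u_t+A_1u=0$.) -/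

import Mathlib

open MeasureTheory Filter Topology Set
open scoped ENNReal NNReal ContDiff

noncomputable section

namespace KawaharaWeighted

/-! ### Weak derivatives and Sobolev spaces on `(0, L)` -/

/-- Lebesgue measure on the open interval `(0, L)`. -/
abbrev volI (L : ℝ) : Measure ℝ := volume.restrict (Ioo 0 L)

/-- The space `𝒟(0, L)` of smooth functions with compact support in `(0, L)`. -/
structure IsTest (L : ℝ) (φ : ℝ → ℝ) : Prop where
  smooth : ContDiff ℝ ∞ φ
  compact : HasCompactSupport φ
  supp : tsupport φ ⊆ Ioo 0 L

/-- `g ∈ L¹_loc(0, L)` is the `n`-th distributional derivative of `u ∈ L¹_loc(0, L)`. -/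
structure HasWeakDeriv (L : ℝ) (n : ℕ) (u g : ℝ → ℝ) : Prop where
  locInt : LocallyIntegrableOn u (Ioo 0 L)
  locInt' : LocallyIntegrableOn g (Ioo 0 L)
  integral_eq : ∀ φ : ℝ → ℝ, IsTest L φ →
    ∫ x in Ioo 0 L, u x * iteratedDeriv n φ x = (-1) ^ n * ∫ x in Ioo 0 L, g x * φ x

/-- `u ∈ H^k(0, L)`. -/
def MemSobolev (L : ℝ) (k : ℕ) (u : ℝ → ℝ) : Prop :=
  ∀ j ≤ k, ∃ g, HasWeakDeriv L j u g ∧ MemLp g 2 (volI L)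

/-- `u ∈ H²₀(0, L)`, the closure of `𝒟(0, L)` in `H²(0, L)`. -/
def MemH20 (L : ℝ) (u : ℝ → ℝ) : Prop :=
  MemSobolev L 2 u ∧ ∃ φ : ℕ → ℝ → ℝ, (∀ m, IsTest L (φ m)) ∧
    ∀ j ≤ 2, ∀ g, HasWeakDeriv L j u g →
      Tendsto (fun m => eLpNorm (fun x => g x - iteratedDeriv j (φ m) x) 2 (volI L)) atTop (𝓝 0)

/-- The measure `x dx` on `(0, L)`. -/
def xMeasure (L : ℝ) : Measure ℝ := (volI L).withDensity (fun x => ENNReal.ofReal x)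

/-- The real Hilbert space `L²_{x dx}` on `(0, L)`. -/
abbrev L2x (L : ℝ) : Type := Lp ℝ 2 (xMeasure L)

lemma ae_volI_of_ae_xMeasure {L : ℝ} {p : ℝ → Prop} (h : ∀ᵐ x ∂xMeasure L, p x) :
    ∀ᵐ x ∂volI L, p x := by
  rw [xMeasure, ae_withDensity_iff (by fun_prop)] at h
  filter_upwards [h, ae_restrict_mem measurableSet_Ioo] with x hx hx0
  exact hx (by simpa using hx0.1)

lemma ae_xMeasure_of_ae_volI {L : ℝ} {p : ℝ → Prop} (h : ∀ᵐ x ∂volI L, p x) :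
    ∀ᵐ x ∂xMeasure L, p x :=
  (withDensity_absolutelyContinuous _ _).ae_le h

lemma xMeasure_le (L : ℝ) : xMeasure L ≤ ENNReal.ofReal L • volI L := by
  rw [xMeasure, ← withDensity_const]
  refine withDensity_mono ?_
  filter_upwards [ae_restrict_mem measurableSet_Ioo] with x hx
  exact ENNReal.ofReal_le_ofReal hx.2.le

lemma MemLp.xMeasure_of_volI {L : ℝ} {g : ℝ → ℝ} (hg : MemLp g 2 (volI L)) :
    MemLp g 2 (xMeasure L) :=
  hg.of_measure_le_smul ENNReal.ofReal_ne_top (xMeasure_le L)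

lemma LocallyIntegrableOn.integrable_mul {L : ℝ} {u ψ : ℝ → ℝ}
    (hu : LocallyIntegrableOn u (Ioo 0 L)) (hc : Continuous ψ) (hψ : HasCompactSupport ψ)
    (hs : tsupport ψ ⊆ Ioo 0 L) : Integrable (fun x => u x * ψ x) (volI L) := by
  have h1 : IntegrableOn (fun x => u x * ψ x) (tsupport ψ) :=
    (hu.integrableOn_compact_subset hs hψ).mul_continuousOn hc.continuousOn hψ
  have h2 : Integrable (fun x => u x * ψ x) := by
    rw [← integrableOn_iff_integrable_of_support_subset (s := tsupport ψ)]
    · exact h1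
    · intro x hx
      exact subset_tsupport _ (right_ne_zero_of_mul hx)
  exact h2.integrableOn

lemma IsTest.iteratedDeriv {L : ℝ} {φ : ℝ → ℝ} (h : IsTest L φ) (n : ℕ) :
    IsTest L (iteratedDeriv n φ) := by
  induction n with
  | zero => simpa using h
  | succ n ih =>
    rw [iteratedDeriv_succ]
    refine ⟨?_, ih.compact.deriv, (tsupport_deriv_subset ..).trans ih.supp⟩
    exact (contDiff_infty_iff_deriv.1 ih.smooth).2

lemma IsTest.add {L : ℝ} {φ ψ : ℝ → ℝ} (h : IsTest L φ) (k : IsTest L ψ) : IsTest L (φ + ψ) :=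
  ⟨h.smooth.add k.smooth, h.compact.add k.compact,
    (tsupport_add φ ψ).trans (union_subset h.supp k.supp)⟩

lemma IsTest.smul {L : ℝ} {φ : ℝ → ℝ} (h : IsTest L φ) (c : ℝ) : IsTest L (c • φ) :=
  ⟨h.smooth.const_smul c, h.compact.smul_left (f := fun _ => c),
    (tsupport_smul_subset_right (fun _ => c) φ).trans h.supp⟩

lemma IsTest.zero (L : ℝ) : IsTest L (0 : ℝ → ℝ) :=
  ⟨contDiff_const, HasCompactSupport.zero, by simp⟩

namespace HasWeakDeriv

variable {L : ℝ} {n : ℕ} {u v g g' : ℝ → ℝ}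

lemma congr (h : HasWeakDeriv L n u g) (huv : u =ᵐ[volI L] v) (hg : g =ᵐ[volI L] g') :
    HasWeakDeriv L n v g' := by
  refine ⟨h.locInt.congr huv, h.locInt'.congr hg, fun φ hφ => ?_⟩
  have e1 : ∫ x in Ioo 0 L, v x * iteratedDeriv n φ x =
      ∫ x in Ioo 0 L, u x * iteratedDeriv n φ x :=
    integral_congr_ae (by filter_upwards [huv] with x hx; rw [hx])
  have e2 : ∫ x in Ioo 0 L, g' x * φ x = ∫ x in Ioo 0 L, g x * φ x :=
    integral_congr_ae (by filter_upwards [hg] with x hx; rw [hx])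
  rw [e1, e2, h.integral_eq φ hφ]

lemma add (h : HasWeakDeriv L n u g) (k : HasWeakDeriv L n v g') :
    HasWeakDeriv L n (u + v) (g + g') := by
  refine ⟨h.locInt.add k.locInt, h.locInt'.add k.locInt', fun φ hφ => ?_⟩
  have hd := hφ.iteratedDeriv n
  have i1 := LocallyIntegrableOn.integrable_mul h.locInt hd.smooth.continuous hd.compact hd.supp
  have i2 := LocallyIntegrableOn.integrable_mul k.locInt hd.smooth.continuous hd.compact hd.supp
  have i3 := LocallyIntegrableOn.integrable_mul h.locInt' hφ.smooth.continuous hφ.compact hφ.supp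
  have i4 := LocallyIntegrableOn.integrable_mul k.locInt' hφ.smooth.continuous hφ.compact hφ.supp
  simp only [Pi.add_apply, add_mul]
  rw [integral_add i1 i2, integral_add i3 i4, h.integral_eq φ hφ, k.integral_eq φ hφ, mul_add]

lemma smul (h : HasWeakDeriv L n u g) (c : ℝ) : HasWeakDeriv L n (c • u) (c • g) := by
  refine ⟨h.locInt.smul c, h.locInt'.smul c, fun φ hφ => ?_⟩
  simp only [Pi.smul_apply, smul_eq_mul, mul_assoc]
  rw [integral_const_mul, integral_const_mul, h.integral_eq φ hφ]
  ring

lemma zero (L : ℝ) (n : ℕ) : HasWeakDeriv L n 0 0 :=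
  ⟨locallyIntegrableOn_zero, locallyIntegrableOn_zero, fun φ _ => by simp⟩

lemma unique (h : HasWeakDeriv L n u g) (k : HasWeakDeriv L n u g') : g =ᵐ[volI L] g' := by
  have key : ∀ᵐ x ∂(volume : Measure ℝ), x ∈ Ioo 0 L → (g - g') x = 0 := by
    refine isOpen_Ioo.ae_eq_zero_of_integral_contDiff_smul_eq_zero (h.locInt'.sub k.locInt') ?_
    intro φ h1 h2 h3
    have hφ : IsTest L φ := ⟨h1, h2, h3⟩
    have e : ∫ x in Ioo 0 L, g x * φ x = ∫ x in Ioo 0 L, g' x * φ x := by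
      have := (h.integral_eq φ hφ).symm.trans (k.integral_eq φ hφ)
      exact mul_left_cancel₀ (pow_ne_zero n (by norm_num)) this
    have i3 := LocallyIntegrableOn.integrable_mul h.locInt' h1.continuous h2 h3
    have i4 := LocallyIntegrableOn.integrable_mul k.locInt' h1.continuous h2 h3
    rw [← setIntegral_eq_integral_of_forall_compl_eq_zero (s := Ioo 0 L)]
    · have : (fun x => φ x • (g - g') x) = fun x => g x * φ x - g' x * φ x := by
        ext x; simp; ring
      rw [this, integral_sub i3 i4, e, sub_self]
    · intro x hx
      rw [image_eq_zero_of_notMem_tsupport (fun hx' => hx (h3 hx')), zero_smul]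
  filter_upwards [(ae_restrict_iff' measurableSet_Ioo).2 key] with x hx
  exact sub_eq_zero.1 hx

lemma aestronglyMeasurable (h : HasWeakDeriv L n u g) : AEStronglyMeasurable g (volI L) :=
  h.locInt'.aestronglyMeasurable

end HasWeakDeriv

open Classical in
/-- The `n`-th weak derivative of `u` on `(0, L)`, determined almost everywhere
(and `0` if there is none). -/
def weakDeriv (L : ℝ) (n : ℕ) (u : ℝ → ℝ) : ℝ → ℝ :=
  if h : ∃ g, HasWeakDeriv L n u g then h.choose else 0

lemma HasWeakDeriv.weakDeriv_ae {L : ℝ} {n : ℕ} {u g : ℝ → ℝ} (h : HasWeakDeriv L n u g) :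
    weakDeriv L n u =ᵐ[volI L] g := by
  have h' : ∃ g, HasWeakDeriv L n u g := ⟨g, h⟩
  rw [weakDeriv, dif_pos h']
  exact h'.choose_spec.unique h

namespace MemSobolev

variable {L : ℝ} {k : ℕ} {u v : ℝ → ℝ}

lemma congr (h : MemSobolev L k u) (huv : u =ᵐ[volI L] v) : MemSobolev L k v := fun j hj =>
  let ⟨g, hg, hg2⟩ := h j hj
  ⟨g, hg.congr huv .rfl, hg2⟩

lemma add (h : MemSobolev L k u) (h' : MemSobolev L k v) : MemSobolev L k (u + v) := fun j hj =>
  let ⟨_, hg, hg2⟩ := h j hj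
  let ⟨_, hf, hf2⟩ := h' j hj
  ⟨_, hg.add hf, hg2.add hf2⟩

lemma smul (h : MemSobolev L k u) (c : ℝ) : MemSobolev L k (c • u) := fun j hj =>
  let ⟨_, hg, hg2⟩ := h j hj
  ⟨_, hg.smul c, hg2.const_smul c⟩

lemma zero (L : ℝ) (k : ℕ) : MemSobolev L k 0 := fun j _ =>
  ⟨0, HasWeakDeriv.zero L j, MemLp.zero⟩

end MemSobolev

namespace MemH20

variable {L : ℝ} {u v : ℝ → ℝ}

lemma congr (h : MemH20 L u) (huv : u =ᵐ[volI L] v) : MemH20 L v := by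
  obtain ⟨hs, φ, hφ, hl⟩ := h
  exact ⟨hs.congr huv, φ, hφ, fun j hj g hg => hl j hj g (hg.congr huv.symm .rfl)⟩

lemma zero (L : ℝ) : MemH20 L 0 := by
  refine ⟨MemSobolev.zero L 2, fun _ => 0, fun _ => IsTest.zero L, fun j _ g hg => ?_⟩
  have e : g =ᵐ[volI L] 0 := hg.unique (HasWeakDeriv.zero L j)
  have e' : eLpNorm g 2 (volI L) = 0 := by rw [eLpNorm_congr_ae e, eLpNorm_zero]
  simp [e']

lemma add (h : MemH20 L u) (h' : MemH20 L v) : MemH20 L (u + v) := by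
  obtain ⟨hs, φ, hφ, hl⟩ := h
  obtain ⟨hs', ψ, hψ, hl'⟩ := h'
  refine ⟨hs.add hs', fun m => φ m + ψ m, fun m => (hφ m).add (hψ m), fun j hj g hg => ?_⟩
  obtain ⟨p, hp, -⟩ := hs j hj
  obtain ⟨q, hq, -⟩ := hs' j hj
  have hlim := (hl j hj p hp).add (hl' j hj q hq)
  rw [add_zero] at hlim
  refine tendsto_of_tendsto_of_tendsto_of_le_of_le tendsto_const_nhds hlim
    (fun _ => zero_le) (fun m => ?_)
  have m1 := ((hφ m).iteratedDeriv j).smooth.continuous.aestronglyMeasurable (μ := volI L)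
  have m2 := ((hψ m).iteratedDeriv j).smooth.continuous.aestronglyMeasurable (μ := volI L)
  refine le_of_eq_of_le (eLpNorm_congr_ae ?_) (eLpNorm_add_le
    (hp.aestronglyMeasurable.sub m1) (hq.aestronglyMeasurable.sub m2) (by norm_num))
  filter_upwards [hg.unique (hp.add hq)] with x hx
  rw [hx, iteratedDeriv_add ((hφ m).smooth.contDiffAt.of_le (by exact_mod_cast le_top))
    ((hψ m).smooth.contDiffAt.of_le (by exact_mod_cast le_top))]
  simp only [Pi.add_apply]
  ring

lemma smul (h : MemH20 L u) (c : ℝ) : MemH20 L (c • u) := by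
  obtain ⟨hs, φ, hφ, hl⟩ := h
  refine ⟨hs.smul c, fun m => c • φ m, fun m => (hφ m).smul c, fun j hj g hg => ?_⟩
  obtain ⟨p, hp, -⟩ := hs j hj
  have hlim := ENNReal.Tendsto.const_mul (a := ‖c‖ₑ) (hl j hj p hp) (Or.inr enorm_ne_top)
  rw [mul_zero] at hlim
  refine hlim.congr fun m => ?_
  rw [← eLpNorm_const_smul]
  refine eLpNorm_congr_ae ?_
  filter_upwards [hg.unique (hp.smul c)] with x hx
  rw [hx, iteratedDeriv_const_smul_field]
  simp only [Pi.smul_apply, smul_eq_mul]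
  ring

end MemH20

/-! ### The operator -/

/-- The conditions describing
`D(A₁) = {u ∈ H⁴(0, L) ∩ H²₀(0, L) : u_xxxxx ∈ L²_{x dx}, u_xx(L) = 0}`.
The value `u_xx(L)` is that of the representative of `u_xx` that is continuous on `[0, L]`. -/
structure MemDomain (L : ℝ) (u : ℝ → ℝ) : Prop where
  sobolev : MemSobolev L 4 u
  h20 : MemH20 L u
  fifth : ∃ g, HasWeakDeriv L 5 u g ∧ MemLp g 2 (xMeasure L)
  trace : ∃ v, HasWeakDeriv L 2 u v ∧ ContinuousOn v (Icc 0 L) ∧ v L = 0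

namespace MemDomain

variable {L : ℝ} {u v : ℝ → ℝ}

lemma congr (h : MemDomain L u) (huv : u =ᵐ[volI L] v) : MemDomain L v := by
  obtain ⟨h1, h2, ⟨g, hg, hg2⟩, ⟨w, hw, hc, h0⟩⟩ := h
  exact ⟨h1.congr huv, h2.congr huv, ⟨g, hg.congr huv .rfl, hg2⟩, ⟨w, hw.congr huv .rfl, hc, h0⟩⟩

lemma zero (L : ℝ) : MemDomain L 0 :=
  ⟨MemSobolev.zero L 4, MemH20.zero L, ⟨0, HasWeakDeriv.zero L 5, MemLp.zero⟩,
    ⟨0, HasWeakDeriv.zero L 2, continuousOn_const, rfl⟩⟩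

lemma add (h : MemDomain L u) (h' : MemDomain L v) : MemDomain L (u + v) := by
  obtain ⟨h1, h2, ⟨g, hg, hg2⟩, ⟨w, hw, hc, h0⟩⟩ := h
  obtain ⟨k1, k2, ⟨f, hf, hf2⟩, ⟨z, hz, kc, k0⟩⟩ := h'
  exact ⟨h1.add k1, h2.add k2, ⟨_, hg.add hf, hg2.add hf2⟩,
    ⟨_, hw.add hz, hc.add kc, by simp [h0, k0]⟩⟩

lemma smul (h : MemDomain L u) (c : ℝ) : MemDomain L (c • u) := by
  obtain ⟨h1, h2, ⟨g, hg, hg2⟩, ⟨w, hw, hc, h0⟩⟩ := h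
  exact ⟨h1.smul c, h2.smul c, ⟨_, hg.smul c, hg2.const_smul c⟩,
    ⟨_, hw.smul c, hc.const_smul c, by simp [h0]⟩⟩

lemma exists_derivs (h : MemDomain L u) : ∃ g₅ g₃, HasWeakDeriv L 5 u g₅ ∧ HasWeakDeriv L 3 u g₃ ∧
    MemLp g₅ 2 (xMeasure L) ∧ MemLp g₃ 2 (xMeasure L) := by
  obtain ⟨g, hg, hg2⟩ := h.fifth
  obtain ⟨f, hf, hf2⟩ := h.sobolev 3 (by norm_num)
  exact ⟨g, f, hg, hf, hg2, MemLp.xMeasure_of_volI hf2⟩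

end MemDomain

/-- `D(A₁)` as a subspace of `L²_{x dx}`. -/
def domainA₁ (L : ℝ) : Submodule ℝ (L2x L) where
  carrier := {u | MemDomain L u}
  zero_mem' := (MemDomain.zero L).congr
    (ae_volI_of_ae_xMeasure (Lp.coeFn_zero ℝ 2 (xMeasure L)).symm)
  add_mem' {u v} hu hv := (MemDomain.add hu hv).congr
    (ae_volI_of_ae_xMeasure (Lp.coeFn_add u v).symm)
  smul_mem' c u hu := (MemDomain.smul hu c).congr
    (ae_volI_of_ae_xMeasure (Lp.coeFn_smul c u).symm)

/-- The function `-u_xxxxx - u_xxx`. -/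
def exprA₁ (L : ℝ) (u : ℝ → ℝ) : ℝ → ℝ := fun x => -weakDeriv L 5 u x - weakDeriv L 3 u x

lemma exprA₁_ae {L : ℝ} {u g₅ g₃ : ℝ → ℝ} (h5 : HasWeakDeriv L 5 u g₅)
    (h3 : HasWeakDeriv L 3 u g₃) : exprA₁ L u =ᵐ[xMeasure L] fun x => -g₅ x - g₃ x :=
  ae_xMeasure_of_ae_volI (by
    filter_upwards [h5.weakDeriv_ae, h3.weakDeriv_ae] with x h h'
    rw [exprA₁, h, h'])

lemma MemDomain.memLp_exprA₁ {L : ℝ} {u : ℝ → ℝ} (h : MemDomain L u) :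
    MemLp (exprA₁ L u) 2 (xMeasure L) := by
  obtain ⟨g, f, hg, hf, hg2, hf2⟩ := h.exists_derivs
  exact (memLp_congr_ae (exprA₁_ae hg hf)).2 (hg2.neg.sub hf2)

/-- The unbounded operator `A₁ u = -u_xxxxx - u_xxx` in `L²_{x dx}`, with domain `D(A₁)`. -/
def A₁ (L : ℝ) : L2x L →ₗ.[ℝ] L2x L where
  domain := domainA₁ L
  toFun :=
    { toFun := fun u => (MemDomain.memLp_exprA₁ u.2).toLp (exprA₁ L u)
      map_add' := by
        intro u v
        rw [← MemLp.toLp_add, MemLp.toLp_eq_toLp_iff]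
        obtain ⟨g, f, hg, hf, -⟩ := MemDomain.exists_derivs u.2
        obtain ⟨g', f', hg', hf', -⟩ := MemDomain.exists_derivs v.2
        have e := ae_volI_of_ae_xMeasure (Lp.coeFn_add (u : L2x L) (v : L2x L)).symm
        filter_upwards [exprA₁_ae hg hf, exprA₁_ae hg' hf',
          exprA₁_ae ((hg.add hg').congr e .rfl) ((hf.add hf').congr e .rfl)] with x h1 h2 h3
        refine h3.trans ?_
        simp only [Pi.add_apply, h1, h2]
        ring
      map_smul' := by
        intro c u
        rw [RingHom.id_apply, ← MemLp.toLp_const_smul, MemLp.toLp_eq_toLp_iff]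
        obtain ⟨g, f, hg, hf, -⟩ := MemDomain.exists_derivs u.2
        have e := ae_volI_of_ae_xMeasure (Lp.coeFn_smul c (u : L2x L)).symm
        filter_upwards [exprA₁_ae hg hf,
          exprA₁_ae ((hg.smul c).congr e .rfl) ((hf.smul c).congr e .rfl)] with x h1 h2
        refine h2.trans ?_
        simp only [Pi.smul_apply, smul_eq_mul, h1]
        ring }

/-! ### Strongly continuous semigroups -/

section Semigroup

variable {E : Type*} [NormedAddCommGroup E] [NormedSpace ℝ E]

/-- `T` is a strongly continuous semigroup of bounded operators on `E`. -/
structure IsC0Semigroup (T : ℝ≥0 → E →L[ℝ] E) : Prop where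
  map_zero : T 0 = ContinuousLinearMap.id ℝ E
  map_add : ∀ s t, T (s + t) = (T s).comp (T t)
  continuous : ∀ x, Continuous fun t => T t x

/-- `A` is the infinitesimal generator of `T`: its domain is the set of all `x` for which
`(T t x - x) / t` converges in `E` as `t → 0+`, and `A x` is the limit. -/
def IsGenerator (A : E →ₗ.[ℝ] E) (T : ℝ≥0 → E →L[ℝ] E) : Prop :=
  ∀ x y, (x, y) ∈ A.graph ↔
    Tendsto (fun t : ℝ≥0 => (t : ℝ)⁻¹ • (T t x - x)) (𝓝[>] 0) (𝓝 y)

/-- `A` generates a strongly continuous semigroup on `E`. -/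
def GeneratesC0Semigroup (A : E →ₗ.[ℝ] E) : Prop :=
  ∃ T : ℝ≥0 → E →L[ℝ] E, IsC0Semigroup T ∧ IsGenerator A T

end Semigroup

end KawaharaWeighted

end

/-! This is the Lumer–Phillips theorem: an operator `A` on a Hilbert space with `⟪A x, x⟫ ≤ a ‖x‖²`
and with `c - A` onto for every `c > a` generates a strongly continuous semigroup
(`generatesC0Semigroup_of_quasidissipative`). It is applied to `-A₁` with `a = L (2 + L²)³`.

Quasi-dissipativity (`quasidissipative_neg_A₁`, through `MemDomain.integral_le`). For `u` in the
domain, integration by parts gives `∫ x (u_xxxxx + u_xxx) u = -(5/2) ∫ u_xx² - ∫ u_xx u - ∫ x u_xx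
u_x`. The boundary terms containing `u` or `u_x` vanish because `u ∈ H²₀`. The remaining one, in `x
u_xx²`, vanishes at `L` because `u_xx(L) = 0` and at `0` because of the weight. The last two
integrals are absorbed by interpolation. Since `∫ u² = -2 ∫ x u u_x`, the unweighted norm of `u` is
controlled by its weighted norm and by `u_x`, so only a multiple of `∫ x u²` remains.

Range condition (`exists_smul_sub_neg_A₁_eq`). A right-hand side `f ∈ L²_{x dx}` need not be
integrable at `0`, but the square of its primitive is `O(log (L / x))`, so the primitive lies in
`L²(0, L)` (`memLp_primitive`). Subtracting an iterated primitive of `-f` leaves a linear ODE with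
continuous data and five boundary conditions, a finite-dimensional problem. The energy inequality
gives uniqueness, hence existence. The solution lies in the domain because vanishing boundary values
characterise `H²₀`; this is a duality argument (`memH20_of_boundary_values`). -/

noncomputable section

namespace KawaharaWeighted

section LumerPhillips

open scoped InnerProductSpace
open NormedSpace (exp)

/-! ### Exponentials of bounded generators of contractions -/

section BoundedGenerators

variable {E : Type*} [NormedAddCommGroup E] [NormedSpace ℝ E] [CompleteSpace E]

lemma exp_add_of_commute_clm {P Q : E →L[ℝ] E} (h : Commute P Q) :
    exp (P + Q) = exp P * exp Q := by
  let +nondep : NormedAlgebra ℚ (E →L[ℝ] E) := .restrictScalars ℚ ℝ _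
  exact NormedSpace.exp_add_of_commute h

lemma norm_exp_smul_le {J : E →L[ℝ] E} (hJ : ‖J‖ ≤ 1) {c : ℝ} (hc : 0 ≤ c) :
    ‖exp (c • J)‖ ≤ Real.exp c := by
  have hp : ∀ n : ℕ, ‖J ^ n‖ ≤ 1 := by
    intro n
    induction n with
    | zero => rw [pow_zero]; exact ContinuousLinearMap.norm_id_le
    | succ n ih =>
      rw [pow_succ]
      exact (norm_mul_le _ _).trans (mul_le_one₀ ih (norm_nonneg _) hJ)
  have h1 := NormedSpace.exp_series_hasSum_exp' (𝕂 := ℝ) (c • J)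
  have h2 := NormedSpace.exp_series_hasSum_exp' (𝕂 := ℝ) c
  rw [← Real.exp_eq_exp_ℝ] at h2
  rw [← h1.tsum_eq]
  refine tsum_of_norm_bounded h2 fun n => ?_
  rw [smul_pow, norm_smul, norm_smul, smul_eq_mul, Real.norm_of_nonneg (by positivity),
    Real.norm_of_nonneg (by positivity)]
  have := hp n
  have h3 : 0 ≤ c ^ n := by positivity
  gcongr
  exact mul_le_of_le_one_right h3 this

/-- The exponential equals `e^{-c} exp (c J)`, and the power series bounds the second factor by
`e^c`. Yosida approximations have the form `c (J - 1)`, so their semigroups are contractions. -/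
lemma norm_exp_smul_sub_one_le {J : E →L[ℝ] E} (hJ : ‖J‖ ≤ 1) {c : ℝ} (hc : 0 ≤ c) :
    ‖exp (c • (J - 1))‖ ≤ 1 := by
  have h1 : c • (J - 1) = c • J + (-c) • (1 : E →L[ℝ] E) := by
    rw [smul_sub, neg_smul, sub_eq_add_neg]
  have hcomm : Commute (c • J) ((-c) • (1 : E →L[ℝ] E)) :=
    ((Commute.one_right J).smul_left c).smul_right (-c)
  have h2 : exp ((-c) • (1 : E →L[ℝ] E)) = Real.exp (-c) • (1 : E →L[ℝ] E) := by
    have := NormedSpace.algebraMap_exp_comm (𝕂 := ℝ) (𝔸 := E →L[ℝ] E) (-c)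
    rw [Algebra.algebraMap_eq_smul_one, Algebra.algebraMap_eq_smul_one] at this
    rw [← this, Real.exp_eq_exp_ℝ]
  rw [h1, exp_add_of_commute_clm hcomm, h2, mul_smul_comm, mul_one, norm_smul,
    Real.norm_of_nonneg (Real.exp_pos _).le]
  have h3 := norm_exp_smul_le hJ hc
  calc Real.exp (-c) * ‖exp (c • J)‖ ≤ Real.exp (-c) * Real.exp c := by gcongr
    _ = 1 := by rw [← Real.exp_add]; simp

lemma hasDerivAt_exp_smul_apply (P : E →L[ℝ] E) (x : E) (s : ℝ) :
    HasDerivAt (fun s : ℝ => exp (s • P) x) (exp (s • P) (P x)) s :=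
  by
  simpa using (hasDerivAt_exp_smul_const (𝕂 := ℝ) P s).clm_apply (hasDerivAt_const s x)

/-- The path `s ↦ exp (t Q) exp (s (P - Q)) x` joins `exp (t Q) x` to `exp (t P) x`. By
commutativity its derivative is `exp ((t - s) Q) exp (s P) (P - Q) x`, a product of contractions
applied to `P x - Q x`. -/
lemma norm_exp_smul_sub_exp_smul_le {P Q : E →L[ℝ] E} (hPQ : Commute P Q)
    (hP : ∀ s : ℝ, 0 ≤ s → ‖exp (s • P)‖ ≤ 1) (hQ : ∀ s : ℝ, 0 ≤ s → ‖exp (s • Q)‖ ≤ 1)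
    {t : ℝ} (ht : 0 ≤ t) (x : E) :
    ‖exp (t • P) x - exp (t • Q) x‖ ≤ t * ‖P x - Q x‖ := by
  have hd : ∀ s : ℝ, HasDerivAt (fun s : ℝ => exp (t • Q) (exp (s • (P - Q)) x))
      (exp (t • Q) (exp (s • (P - Q)) ((P - Q) x))) s := fun s =>
    (exp (t • Q)).hasFDerivAt.comp_hasDerivAt s (hasDerivAt_exp_smul_apply (P - Q) x s)
  have hb : ∀ s ∈ Ico 0 t, ‖exp (t • Q) (exp (s • (P - Q)) ((P - Q) x))‖ ≤ ‖P x - Q x‖ := by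
    intro s hs
    have hc : Commute ((t - s) • Q) (s • P) := (hPQ.symm.smul_left _).smul_right _
    have hc' : Commute (t • Q) (s • (P - Q)) :=
      ((hPQ.symm.sub_right (Commute.refl Q)).smul_left _).smul_right _
    have e : exp (t • Q) * exp (s • (P - Q)) = exp ((t - s) • Q) * exp (s • P) := by
      rw [← exp_add_of_commute_clm hc, ← exp_add_of_commute_clm hc']
      congr 1
      rw [sub_smul, smul_sub]; abel
    rw [← mul_apply_eq_comp, e, mul_apply_eq_comp]
    calc _ ≤ ‖exp (s • P) ((P - Q) x)‖ :=
          ContinuousLinearMap.le_of_opNorm_le_of_le _ (hQ _ (by linarith [hs.2])) le_rfl |>.trans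
            (by rw [one_mul])
      _ ≤ ‖(P - Q) x‖ :=
          ContinuousLinearMap.le_of_opNorm_le_of_le _ (hP _ hs.1) le_rfl |>.trans (by rw [one_mul])
      _ = _ := by rw [sub_apply]
  have := norm_image_sub_le_of_norm_deriv_le_segment' (fun s _ => (hd s).hasDerivWithinAt) hb t
    (right_mem_Icc.2 ht)
  have e : exp (t • Q) (exp (t • (P - Q)) x) = exp (t • P) x := by
    have hc' : Commute (t • Q) (t • (P - Q)) :=
      ((hPQ.symm.sub_right (Commute.refl Q)).smul_left _).smul_right _
    rw [← mul_apply_eq_comp, ← exp_add_of_commute_clm hc', ← smul_add,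
      add_sub_cancel]
  rw [e] at this
  simpa [NormedSpace.exp_zero, mul_comm] using this

lemma norm_exp_smul_sub_self_le {P : E →L[ℝ] E} (hP : ∀ s : ℝ, 0 ≤ s → ‖exp (s • P)‖ ≤ 1)
    {t : ℝ} (ht : 0 ≤ t) (x : E) : ‖exp (t • P) x - x‖ ≤ t * ‖P x‖ := by
  have h0 : ∀ s : ℝ, 0 ≤ s → ‖exp (s • (0 : E →L[ℝ] E))‖ ≤ 1 := fun s _ => by
    rw [smul_zero, NormedSpace.exp_zero]
    exact ContinuousLinearMap.norm_id_le
  simpa [NormedSpace.exp_zero] using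
    norm_exp_smul_sub_exp_smul_le (Commute.zero_right P) hP h0 ht x

/-- A second-order Taylor bound would involve `P (P x)`, which need not stay bounded along Yosida
approximations. Replacing `P x` by a nearby `z` costs `2 ‖P x - z‖` and leaves only `‖P z‖`, which
is controlled when `z` is in the domain of the limit operator. -/
lemma norm_exp_smul_sub_self_sub_le {P : E →L[ℝ] E}
    (hP : ∀ s : ℝ, 0 ≤ s → ‖exp (s • P)‖ ≤ 1) {t : ℝ} (ht : 0 ≤ t) (x z : E) :
    ‖exp (t • P) x - x - t • P x‖ ≤ t * (2 * ‖P x - z‖ + t * ‖P z‖) := by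
  have hd : ∀ s : ℝ, HasDerivAt (fun s : ℝ => exp (s • P) x - s • P x)
      (exp (s • P) (P x) - P x) s := fun s =>
    (hasDerivAt_exp_smul_apply P x s).sub (by simpa using (hasDerivAt_id s).smul_const (P x))
  have hb : ∀ s ∈ Ico 0 t, ‖exp (s • P) (P x) - P x‖ ≤ 2 * ‖P x - z‖ + t * ‖P z‖ := by
    intro s hs
    have e : exp (s • P) (P x) - P x
        = exp (s • P) (P x - z) + (exp (s • P) z - z) - (P x - z) := by
      rw [map_sub]; abel
    have h1 : ‖exp (s • P) (P x - z)‖ ≤ ‖P x - z‖ :=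
      ContinuousLinearMap.le_of_opNorm_le_of_le _ (hP _ hs.1) le_rfl |>.trans (by rw [one_mul])
    have h2 := norm_exp_smul_sub_self_le hP hs.1 z
    have h3 : s * ‖P z‖ ≤ t * ‖P z‖ := by gcongr; exact hs.2.le
    rw [e]
    refine (norm_sub_le _ _).trans ?_
    have := norm_add_le (exp (s • P) (P x - z)) (exp (s • P) z - z)
    linarith
  have := norm_image_sub_le_of_norm_deriv_le_segment' (fun s _ => (hd s).hasDerivWithinAt) hb t
    (right_mem_Icc.2 ht)
  have e : exp (t • P) x - x - t • P x = exp (t • P) x - t • P x - x := by abel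
  rw [e]
  simpa [NormedSpace.exp_zero, mul_comm] using this

end BoundedGenerators

/-! ### Dissipative operators and the Lumer–Phillips theorem on a Hilbert space -/

variable {H : Type*} [NormedAddCommGroup H] [InnerProductSpace ℝ H]

/-- `B` is dissipative. -/
def IsDissipative (B : H →ₗ.[ℝ] H) : Prop := ∀ x : B.domain, ⟪B x, (x : H)⟫_ℝ ≤ 0

namespace IsDissipative

variable {B : H →ₗ.[ℝ] H}

/-- Pair `c x - B x` with `x` and apply Cauchy–Schwarz. -/
lemma mul_norm_le (hB : IsDissipative B) (c : ℝ) (x : B.domain) :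
    c * ‖(x : H)‖ ≤ ‖c • (x : H) - B x‖ := by
  rcases eq_or_ne (x : H) 0 with h | h
  · rw [h, norm_zero, mul_zero]; exact norm_nonneg _
  have h1 : c * ‖(x : H)‖ ^ 2 ≤ ‖c • (x : H) - B x‖ * ‖(x : H)‖ := by
    refine le_trans ?_ (real_inner_le_norm _ _)
    rw [inner_sub_left, real_inner_smul_left, real_inner_self_eq_norm_sq]
    linarith [hB x]
  have h2 : 0 < ‖(x : H)‖ := norm_pos_iff.2 h
  refine le_of_mul_le_mul_right ?_ h2
  linarith

lemma eq_of_smul_sub_eq (hB : IsDissipative B) {c : ℝ} (hc : 0 < c) {x y : B.domain}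
    (h : c • (x : H) - B x = c • (y : H) - B y) : x = y := by
  have h1 := hB.mul_norm_le c (x - y)
  have h2 : c • ((x - y : B.domain) : H) - B (x - y) = 0 := by
    rw [LinearPMap.map_sub, Submodule.coe_sub, smul_sub]
    rw [← sub_eq_zero] at h
    rw [← h]; abel
  rw [h2, norm_zero] at h1
  have h3 : ‖((x - y : B.domain) : H)‖ ≤ 0 := by
    by_contra h4
    have := mul_pos hc (not_le.1 h4)
    linarith
  have h4 := norm_le_zero_iff.1 h3
  exact sub_eq_zero.1 (Subtype.ext h4)

/-- Existence of the contraction `c (c - B)⁻¹`. -/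
lemma exists_resolvent (hB : IsDissipative B) {c : ℝ} (hc : 0 < c)
    (hs : ∀ f : H, ∃ x : B.domain, c • (x : H) - B x = f) :
    ∃ J : H →L[ℝ] H, ‖J‖ ≤ 1 ∧ ∀ f, ∃ h : J f ∈ B.domain, c • J f - B ⟨J f, h⟩ = c • f := by
  choose r hr using fun f : H => hs (c • f)
  let R : H →ₗ[ℝ] H :=
    { toFun := fun f => r f
      map_add' := fun f g => by
        rw [← Submodule.coe_add]
        congr 1
        apply hB.eq_of_smul_sub_eq hc
        rw [hr, LinearPMap.map_add, Submodule.coe_add, smul_add, smul_add, add_sub_add_comm,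
          hr, hr]
      map_smul' := fun a f => by
        rw [RingHom.id_apply, ← Submodule.coe_smul]
        congr 1
        apply hB.eq_of_smul_sub_eq hc
        rw [hr, LinearPMap.map_smul, Submodule.coe_smul, smul_comm c a f,
          smul_comm c a (r f : H), ← smul_sub, hr] }
  refine ⟨R.mkContinuous 1 fun f => ?_, R.mkContinuous_norm_le zero_le_one _, fun f => ?_⟩
  · have := hB.mul_norm_le c (r f)
    rw [hr, norm_smul, Real.norm_of_nonneg hc.le] at this
    rw [one_mul]
    exact le_of_mul_le_mul_left this hc
  · exact ⟨(r f).2, hr f⟩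

/-- If `v` is orthogonal to the domain, write `v = x - B x`. Pairing with `x` gives `‖x‖² = ⟪x, B x⟫
≤ 0`, so `x = 0` and `v = 0`. -/
lemma dense_domain [CompleteSpace H] (hB : IsDissipative B)
    (hs : ∀ f : H, ∃ x : B.domain, (1 : ℝ) • (x : H) - B x = f) :
    Dense (B.domain : Set H) := by
  rw [Submodule.dense_iff_topologicalClosure_eq_top,
    Submodule.topologicalClosure_eq_top_iff, Submodule.eq_bot_iff]
  intro v hv
  obtain ⟨x, hx⟩ := hs v
  have h1 : ⟪(x : H), v⟫_ℝ = 0 := hv x x.2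
  rw [← hx, inner_sub_right, real_inner_smul_right, real_inner_self_eq_norm_sq] at h1
  have h2 := hB x
  rw [real_inner_comm] at h2
  have h3 : ‖(x : H)‖ ^ 2 ≤ 0 := by linarith
  have h4 : (x : H) = 0 := by
    rw [← norm_eq_zero]
    exact pow_eq_zero_iff two_ne_zero |>.1 (le_antisymm h3 (sq_nonneg _))
  have h5 : x = 0 := Subtype.ext h4
  rw [← hx, h5]
  simp

end IsDissipative

/-- **Lumer–Phillips theorem** for contraction semigroups on a Hilbert space. -/
theorem IsDissipative.exists_semigroup [CompleteSpace H] {B : H →ₗ.[ℝ] H}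
    (hB : IsDissipative B)
    (hs : ∀ c : ℝ, 0 < c → ∀ f : H, ∃ x : B.domain, c • (x : H) - B x = f) :
    ∃ T : ℝ≥0 → H →L[ℝ] H, IsC0Semigroup T ∧ IsGenerator B T := by
  -- The resolvent parameter is `n + 1`, so that it is positive also for `n = 0`.
  have hpos : ∀ n : ℕ, (0 : ℝ) < n + 1 := fun n => by positivity
  choose J hJ1 hJd hJ using fun n : ℕ => hB.exists_resolvent (hpos n) (hs _ (hpos n))
  have hdense := hB.dense_domain (hs 1 one_pos)
  -- The Yosida approximations `B J n`: bounded, pairwise commuting, and converging to `B` on its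
  -- domain.
  let Y : ℕ → H →L[ℝ] H := fun n => ((n : ℝ) + 1) • (J n - 1)
  have hY : ∀ n x, Y n x = ((n : ℝ) + 1) • J n x - ((n : ℝ) + 1) • x := fun n x => by
    simp [Y, smul_sub]
  have hBJ : ∀ n x, B ⟨J n x, hJd n x⟩ = Y n x := fun n x => by
    rw [hY, ← hJ n x]; abel
  have hJB : ∀ n (x : B.domain), J n (B x) = Y n x := by
    intro n x
    have h1 : (⟨J n (((n : ℝ) + 1) • (x : H) - B x), hJd n _⟩ : B.domain)
        = ((n : ℝ) + 1) • x := by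
      apply hB.eq_of_smul_sub_eq (hpos n)
      rw [hJ, LinearPMap.map_smul, Submodule.coe_smul, ← smul_sub]
    have h2 := congrArg (Subtype.val) h1
    simp only [map_sub, map_smul, Submodule.coe_smul] at h2
    rw [hY, ← h2]; abel
  have hcomm : ∀ m n, Commute (J m) (J n) := by
    intro m n
    ext f
    rw [mul_apply_eq_comp, mul_apply_eq_comp]
    have h1 : (⟨J m (J n f), hJd _ _⟩ : B.domain) = ⟨J n (J m f), hJd _ _⟩ := by
      apply hB.eq_of_smul_sub_eq (hpos m)
      rw [hJ, hBJ, ← hJB n ⟨J m f, hJd m f⟩, ← map_smul (J n), ← hJ m f, map_sub, map_smul]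
    exact congrArg Subtype.val h1
  have hYcomm : ∀ m n, Commute (Y m) (Y n) := fun m n =>
    ((((hcomm m n).sub_right (Commute.one_right _)).sub_left
      (Commute.one_left _)).smul_left _).smul_right _
  have hexp : ∀ n (s : ℝ), 0 ≤ s → ‖exp (s • Y n)‖ ≤ 1 := fun n s hs => by
    rw [smul_smul]
    exact norm_exp_smul_sub_one_le (hJ1 n) (mul_nonneg hs (hpos n).le)
  have hexp' : ∀ n (s : ℝ), 0 ≤ s → ∀ x, ‖exp (s • Y n) x‖ ≤ ‖x‖ := fun n s hs x =>
    (ContinuousLinearMap.le_of_opNorm_le_of_le _ (hexp n s hs) le_rfl).trans (by rw [one_mul])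
  -- On the domain, `(n + 1) (J n z - z) = J n (B z)` stays bounded. Density and `‖J n‖ ≤ 1` extend
  -- the convergence to all of `H`.
  have hJlim : ∀ x, Tendsto (fun n => J n x) atTop (𝓝 x) := by
    intro x
    rw [Metric.tendsto_atTop]
    intro ε hε
    obtain ⟨z, hz, hzx⟩ := Metric.dense_iff.1 hdense x (ε / 3) (by positivity)
    obtain ⟨N, hN⟩ := exists_nat_gt (3 * ‖B ⟨z, hzx⟩‖ / ε)
    refine ⟨N, fun n hn => ?_⟩
    have h1 : ‖J n z - z‖ < ε / 3 := by
      have e : ((n : ℝ) + 1) • (J n z - z) = J n (B ⟨z, hzx⟩) := by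
        rw [hJB, hY, smul_sub]
      have h2 : ((n : ℝ) + 1) * ‖J n z - z‖ ≤ ‖B ⟨z, hzx⟩‖ := by
        rw [← Real.norm_of_nonneg (hpos n).le, ← norm_smul, e]
        exact (ContinuousLinearMap.le_of_opNorm_le_of_le _ (hJ1 n) le_rfl).trans (by rw [one_mul])
      have h3 : (N : ℝ) ≤ n := by exact_mod_cast hn
      rw [div_lt_iff₀ hε] at hN
      by_contra h4
      rw [not_lt] at h4
      have h5 : ((n : ℝ) + 1) * (ε / 3) ≤ ((n : ℝ) + 1) * ‖J n z - z‖ := by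
        gcongr
      nlinarith
    have h2 : ‖J n (x - z)‖ ≤ ‖x - z‖ :=
      (ContinuousLinearMap.le_of_opNorm_le_of_le _ (hJ1 n) le_rfl).trans (by rw [one_mul])
    have h3 : ‖x - z‖ < ε / 3 := by
      rw [← dist_eq_norm, dist_comm]; exact hz
    have e : J n x - x = J n (x - z) + (J n z - z) - (x - z) := by rw [map_sub]; abel
    rw [dist_eq_norm, e]
    have h4 := norm_sub_le (J n (x - z) + (J n z - z)) (x - z)
    have h5 := norm_add_le (J n (x - z)) (J n z - z)
    linarith
  have hYlim : ∀ x : B.domain, Tendsto (fun n => Y n x) atTop (𝓝 (B x)) := fun x => by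
    simpa only [← hJB] using hJlim (B x)
  have hcauchy : ∀ (t : ℝ≥0) (x : H), CauchySeq fun n => exp ((t : ℝ) • Y n) x := by
    intro t x
    rw [Metric.cauchySeq_iff]
    intro ε hε
    obtain ⟨z, hz, hzx⟩ := Metric.dense_iff.1 hdense x (ε / 3) (by positivity)
    obtain ⟨N, hN⟩ := Metric.cauchySeq_iff.1 (hYlim ⟨z, hzx⟩).cauchySeq (ε / (3 * (t + 1)))
      (by positivity)
    refine ⟨N, fun m hm n hn => ?_⟩
    have h1 := hN m hm n hn
    have h2 := norm_exp_smul_sub_exp_smul_le (hYcomm m n) (hexp m) (hexp n) t.2 z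
    rw [dist_eq_norm] at h1 ⊢
    have h3 : (t : ℝ) * ‖Y m z - Y n z‖ ≤ ε / 3 := by
      rw [lt_div_iff₀ (by positivity)] at h1
      have := norm_nonneg (Y m z - Y n z)
      nlinarith
    have h4 : ‖x - z‖ < ε / 3 := by
      rw [← dist_eq_norm, dist_comm]; exact hz
    have h5 := hexp' m t t.2 (x - z)
    have h6 := hexp' n t t.2 (x - z)
    have e : exp ((t : ℝ) • Y m) x - exp ((t : ℝ) • Y n) x
        = exp ((t : ℝ) • Y m) (x - z) + (exp ((t : ℝ) • Y m) z - exp ((t : ℝ) • Y n) z)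
          - exp ((t : ℝ) • Y n) (x - z) := by
      rw [map_sub, map_sub]; abel
    rw [e]
    have h7 := norm_sub_le (exp ((t : ℝ) • Y m) (x - z)
      + (exp ((t : ℝ) • Y m) z - exp ((t : ℝ) • Y n) z)) (exp ((t : ℝ) • Y n) (x - z))
    have h8 := norm_add_le (exp ((t : ℝ) • Y m) (x - z))
      (exp ((t : ℝ) • Y m) z - exp ((t : ℝ) • Y n) z)
    have h9 : ‖exp ((t : ℝ) • Y m) z - exp ((t : ℝ) • Y n) z‖ ≤ ε / 3 := h2.trans h3
    linarith
  choose S hS using fun t x => cauchySeq_tendsto_of_complete (hcauchy t x)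
  have hSle : ∀ t x, ‖S t x‖ ≤ ‖x‖ := fun t x =>
    le_of_tendsto (hS t x).norm (Eventually.of_forall fun n => hexp' n t t.2 x)
  let T : ℝ≥0 → H →L[ℝ] H := fun t =>
    LinearMap.mkContinuous
      { toFun := S t
        map_add' := fun x y => tendsto_nhds_unique (hS t (x + y))
          (by simpa only [map_add] using (hS t x).add (hS t y))
        map_smul' := fun c x => tendsto_nhds_unique (hS t (c • x))
          (by
            rw [RingHom.id_apply]
            simpa only [map_smul] using (hS t x).const_smul c) } 1
      fun x => by rw [one_mul]; exact hSle t x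
  have hT : ∀ (t : ℝ≥0) x, Tendsto (fun n => exp ((t : ℝ) • Y n) x) atTop (𝓝 (T t x)) := hS
  have hTle : ∀ t x, ‖T t x‖ ≤ ‖x‖ := hSle
  have hT0 : T 0 = ContinuousLinearMap.id ℝ H := by
    ext x
    refine tendsto_nhds_unique (hT 0 x) ?_
    simp [NormedSpace.exp_zero]
  have hTadd : ∀ s t, T (s + t) = (T s).comp (T t) := by
    intro s t
    ext x
    refine tendsto_nhds_unique (hT (s + t) x) ?_
    rw [ContinuousLinearMap.comp_apply]
    have h1 : ∀ n, exp (((s + t : ℝ≥0) : ℝ) • Y n) x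
        = exp ((s : ℝ) • Y n) (T t x) + exp ((s : ℝ) • Y n) (exp ((t : ℝ) • Y n) x - T t x) := by
      intro n
      rw [← map_add, add_sub_cancel, NNReal.coe_add, add_smul, exp_add_of_commute_clm
        (((Commute.refl (Y n)).smul_left _).smul_right _), mul_apply_eq_comp]
    simp only [h1]
    have h2 : Tendsto (fun n => exp ((s : ℝ) • Y n) (exp ((t : ℝ) • Y n) x - T t x)) atTop
        (𝓝 0) := by
      refine squeeze_zero_norm (fun n => hexp' n s s.2 _) ?_
      have := (hT t x).sub_const (T t x)
      rw [sub_self] at this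
      simpa using this.norm
    simpa only [add_zero] using (hT s (T t x)).add h2
  have hgen : ∀ (x : B.domain) (z : B.domain) (t : ℝ≥0),
      ‖T t x - x - (t : ℝ) • B x‖ ≤ t * (2 * ‖B x - z‖ + t * ‖B z‖) := by
    intro x z t
    refine le_of_tendsto_of_tendsto' (((hT t x).sub_const (x : H)).sub
      ((hYlim x).const_smul (t : ℝ))).norm
      ((((((hYlim x).sub_const (z : H)).norm).const_mul 2).add
        ((hYlim z).norm.const_mul (t : ℝ))).const_mul (t : ℝ)) fun n => ?_
    exact norm_exp_smul_sub_self_sub_le (hexp n) t.2 (x : H) (z : H)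
  have hTB : ∀ (x : B.domain) (t : ℝ≥0), ‖T t x - x‖ ≤ t * ‖B x‖ := by
    intro x t
    refine le_of_tendsto_of_tendsto' ((hT t x).sub_const (x : H)).norm
      ((hYlim x).norm.const_mul (t : ℝ)) fun n => ?_
    exact norm_exp_smul_sub_self_le (hexp n) t.2 (x : H)
  have hcont : ∀ x, Continuous fun t => T t x := by
    intro x
    have hsub : ∀ s t : ℝ≥0, s ≤ t → ‖T t x - T s x‖ ≤ ‖T (t - s) x - x‖ := by
      intro s t hst
      have e : T t x - T s x = T s (T (t - s) x - x) := by
        rw [map_sub, ← ContinuousLinearMap.comp_apply, ← hTadd, add_tsub_cancel_of_le hst]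
      rw [e]
      exact hTle _ _
    rw [Metric.continuous_iff]
    intro t ε hε
    obtain ⟨z, hz, hzx⟩ := Metric.dense_iff.1 hdense x (ε / 3) (by positivity)
    refine ⟨ε / (3 * (‖B ⟨z, hzx⟩‖ + 1)), by positivity, fun s hst => ?_⟩
    have key : ∀ r : ℝ≥0, (r : ℝ) < ε / (3 * (‖B ⟨z, hzx⟩‖ + 1)) → ‖T r x - x‖ < ε := by
      intro r hr
      rw [lt_div_iff₀ (by positivity)] at hr
      have h1 := hTB ⟨z, hzx⟩ r
      have h2 := hTle r (x - z)
      have h3 : ‖x - z‖ < ε / 3 := by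
        rw [← dist_eq_norm, dist_comm]; exact hz
      have e : T r x - x = T r (x - z) + (T r z - z) - (x - z) := by rw [map_sub]; abel
      rw [e]
      have h4 := norm_sub_le (T r (x - z) + (T r z - z)) (x - z)
      have h5 := norm_add_le (T r (x - z)) (T r z - z)
      have h6 : ‖T r z - z‖ ≤ ε / 3 := h1.trans (by nlinarith [r.2])
      linarith
    rcases le_total s t with h | h
    · rw [dist_comm, dist_eq_norm]
      refine (hsub s t h).trans_lt (key _ ?_)
      rw [NNReal.coe_sub h]
      rw [NNReal.dist_eq, abs_sub_comm] at hst
      exact (le_abs_self _).trans_lt hst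
    · rw [dist_eq_norm]
      refine (hsub t s h).trans_lt (key _ ?_)
      rw [NNReal.coe_sub h]
      rw [NNReal.dist_eq] at hst
      exact (le_abs_self _).trans_lt hst
  have hforward : ∀ x : B.domain,
      Tendsto (fun t : ℝ≥0 => (t : ℝ)⁻¹ • (T t x - (x : H))) (𝓝[>] 0) (𝓝 (B x)) := by
    intro x
    rw [Metric.tendsto_nhds]
    intro ε hε
    obtain ⟨z, hz, hzx⟩ := Metric.dense_iff.1 hdense (B x) (ε / 4) (by positivity)
    have hδ : (0 : ℝ) < ε / (2 * (‖B ⟨z, hzx⟩‖ + 1)) := by positivity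
    have h0 : ∀ᶠ t : ℝ≥0 in 𝓝[>] 0, (t : ℝ) < ε / (2 * (‖B ⟨z, hzx⟩‖ + 1)) := by
      refine nhdsWithin_le_nhds ?_
      exact (NNReal.continuous_coe.tendsto 0).eventually (gt_mem_nhds (by simpa using hδ))
    filter_upwards [h0, self_mem_nhdsWithin] with t ht1 ht2
    have ht0 : (0 : ℝ) < t := by exact_mod_cast ht2
    have h1 := hgen x ⟨z, hzx⟩ t
    have e : (t : ℝ)⁻¹ • (T t x - (x : H)) - B x
        = (t : ℝ)⁻¹ • (T t x - x - (t : ℝ) • B x) := by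
      rw [smul_sub (t : ℝ)⁻¹ _ ((t : ℝ) • B x), smul_smul, inv_mul_cancel₀ ht0.ne', one_smul]
    rw [dist_eq_norm, e, norm_smul, norm_inv, Real.norm_of_nonneg ht0.le]
    have h3 : ‖B x - z‖ < ε / 4 := by
      rw [← dist_eq_norm, dist_comm]; exact hz
    have h4 : (t : ℝ)⁻¹ * ‖T t x - x - (t : ℝ) • B x‖
        ≤ 2 * ‖B x - z‖ + t * ‖B ⟨z, hzx⟩‖ := by
      rw [inv_mul_le_iff₀ ht0]; exact h1
    rw [lt_div_iff₀ (by positivity)] at ht1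
    nlinarith
  refine ⟨T, ⟨hT0, hTadd, hcont⟩, fun x y => ⟨fun h => ?_, fun h => ?_⟩⟩
  · obtain ⟨w, hw1, hw2⟩ := LinearPMap.mem_graph_iff _ |>.1 h
    simp only at hw1 hw2
    rw [← hw1, ← hw2]
    exact hforward w
  -- Maximality of `B`: choose `z` with `z - B z = x - y`, so that `y - B z = x - z`. The generator
  -- of a contraction semigroup is dissipative, hence `⟪y - B z, x - z⟫ ≤ 0`, which forces `x = z`.
  · obtain ⟨z, hz⟩ := hs 1 one_pos (x - y)
    have h1 := (h.sub (hforward z))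
    have h2 : ⟪y - B z, x - z⟫_ℝ ≤ 0 := by
      refine le_of_tendsto (h1.inner tendsto_const_nhds) (Eventually.of_forall fun t => ?_)
      rw [← smul_sub, real_inner_smul_left]
      refine mul_nonpos_of_nonneg_of_nonpos (inv_nonneg.2 t.2) ?_
      have e : T t x - x - (T t z - z) = T t (x - z) - (x - z) := by rw [map_sub]; abel
      rw [e, inner_sub_left, real_inner_self_eq_norm_sq]
      have := real_inner_le_norm (T t (x - z)) (x - z)
      have := hTle t (x - z)
      nlinarith [norm_nonneg (x - (z : H))]
    have e : y - B z = x - z := by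
      rw [one_smul] at hz
      have : B z = z - (x - y) := by rw [← hz]; abel
      rw [this]; abel
    rw [e, real_inner_self_eq_norm_sq] at h2
    have h3 : x - (z : H) = 0 := by
      rw [← norm_eq_zero]
      exact pow_eq_zero_iff two_ne_zero |>.1 (le_antisymm h2 (sq_nonneg _))
    rw [h3] at e
    rw [LinearPMap.mem_graph_iff]
    exact ⟨z, (sub_eq_zero.1 h3).symm, (sub_eq_zero.1 e).symm⟩

lemma tendsto_exp_smul_difference {T : ℝ≥0 → H →L[ℝ] H} {x y : H} (a : ℝ)
    (h : Tendsto (fun t : ℝ≥0 => (t : ℝ)⁻¹ • (T t x - x)) (𝓝[>] 0) (𝓝 y)) :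
    Tendsto (fun t : ℝ≥0 => (t : ℝ)⁻¹ • (Real.exp (a * t) • T t x - x)) (𝓝[>] 0)
      (𝓝 (y + a • x)) := by
  have h0 : Tendsto (fun t : ℝ≥0 => (t : ℝ)) (𝓝[>] 0) (𝓝[≠] 0) := by
    refine tendsto_nhdsWithin_iff.2 ⟨?_, ?_⟩
    · exact (NNReal.continuous_coe.tendsto' 0 0 rfl).mono_left nhdsWithin_le_nhds
    · filter_upwards [self_mem_nhdsWithin] with t ht
      exact_mod_cast ht.ne'
  have h1 : Tendsto (fun t : ℝ≥0 => Real.exp (a * t)) (𝓝[>] 0) (𝓝 1) := by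
    have : Continuous fun t : ℝ≥0 => Real.exp (a * t) := by fun_prop
    exact (this.tendsto' 0 1 (by simp)).mono_left nhdsWithin_le_nhds
  have h2 : Tendsto (fun t : ℝ≥0 => (t : ℝ)⁻¹ • (Real.exp (a * t) - 1)) (𝓝[>] 0) (𝓝 a) := by
    have hd : HasDerivAt (fun s : ℝ => Real.exp (a * s)) a 0 := by
      simpa using ((hasDerivAt_id (0 : ℝ)).const_mul a).exp
    have := (hasDerivAt_iff_tendsto_slope_zero.1 hd).comp h0
    simpa [Function.comp_def] using this
  refine ((h1.smul h).add (h2.smul_const x)).congr' ?_ |>.trans (by rw [one_smul])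
  refine Eventually.of_forall fun t => ?_
  simp only []
  rw [smul_comm, smul_assoc, ← smul_add, smul_sub, sub_smul, one_smul]
  congr 1; abel

/-- **Lumer–Phillips theorem**, quasi-dissipative version. -/
theorem generatesC0Semigroup_of_quasidissipative [CompleteSpace H] {A : H →ₗ.[ℝ] H} {a : ℝ}
    (hA : ∀ x : A.domain, ⟪A x, (x : H)⟫_ℝ ≤ a * ‖(x : H)‖ ^ 2)
    (hs : ∀ c : ℝ, a < c → ∀ f : H, ∃ x : A.domain, c • (x : H) - A x = f) :
    GeneratesC0Semigroup A := by
  -- The shift by `a` makes the operator dissipative; the factor `e^{a t}` on the semigroup undoes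
  -- it.
  let B : H →ₗ.[ℝ] H := ⟨A.domain, A.toFun - a • A.domain.subtype⟩
  have hB : ∀ x : A.domain, B x = A x - a • (x : H) := fun x => rfl
  have hdis : IsDissipative B := by
    intro x
    rw [hB, inner_sub_left, real_inner_smul_left, real_inner_self_eq_norm_sq]
    linarith [hA x]
  obtain ⟨T, hT, hTB⟩ := hdis.exists_semigroup fun c hc f => by
    obtain ⟨x, hx⟩ := hs (c + a) (by linarith) f
    refine ⟨x, ?_⟩
    rw [hB, ← hx, add_smul]; abel
  refine ⟨fun t => Real.exp (a * t) • T t, ⟨?_, ?_, ?_⟩, fun x y => ?_⟩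
  · simp [hT.map_zero]
  · intro s t
    rw [hT.map_add, ContinuousLinearMap.smul_comp, ContinuousLinearMap.comp_smul, smul_smul,
      ← Real.exp_add, NNReal.coe_add, mul_add]
  · intro x
    have := hT.continuous x
    simp only [smul_apply]
    fun_prop
  · have hg : (x, y) ∈ A.graph ↔ (x, y - a • x) ∈ B.graph := by
      rw [LinearPMap.mem_graph_iff, LinearPMap.mem_graph_iff]
      constructor
      · rintro ⟨z, hz1, hz2⟩
        simp only at hz1 hz2
        exact ⟨z, hz1, by rw [hB, hz1, hz2]⟩
      · rintro ⟨z, hz1, hz2⟩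
        simp only at hz1 hz2
        refine ⟨z, hz1, ?_⟩
        rw [hB, hz1] at hz2
        exact sub_left_inj.1 hz2
    rw [hg, hTB]
    constructor
    · intro h
      simpa using tendsto_exp_smul_difference a h
    · intro h
      -- The converse is the same product rule, applied to the rescaled semigroup with `-a`.
      have := tendsto_exp_smul_difference (T := fun t => Real.exp (a * t) • T t) (-a) h
      simpa [smul_smul, ← Real.exp_add, sub_eq_add_neg] using this

end LumerPhillips

/-! ### Test functions -/

lemma setIntegral_Ioo_eq {L : ℝ} (hL : 0 ≤ L) (f : ℝ → ℝ) :
    ∫ x in Ioo 0 L, f x = ∫ x in (0)..L, f x := by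
  rw [intervalIntegral.integral_of_le hL, integral_Ioc_eq_integral_Ioo]

lemma iteratedDeriv_iteratedDeriv (m n : ℕ) (f : ℝ → ℝ) :
    iteratedDeriv m (iteratedDeriv n f) = iteratedDeriv (m + n) f := by
  simp only [iteratedDeriv_eq_iterate, Function.iterate_add_apply]

namespace IsTest

variable {L : ℝ} {φ ψ : ℝ → ℝ}

lemma continuous (h : IsTest L φ) : Continuous φ := h.smooth.continuous

lemma differentiable (h : IsTest L φ) : Differentiable ℝ φ :=
  h.smooth.differentiable (by simp)

lemma deriv (h : IsTest L φ) : IsTest L (deriv φ) := by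
  simpa using h.iteratedDeriv 1

lemma hasDerivAt (h : IsTest L φ) (x : ℝ) : HasDerivAt φ (_root_.deriv φ x) x :=
  (h.differentiable x).hasDerivAt

lemma sub (h : IsTest L φ) (k : IsTest L ψ) : IsTest L (φ - ψ) := by
  have := h.add (k.smul (-1))
  rwa [neg_one_smul, ← sub_eq_add_neg] at this

/-- The functions `x φ` carry the weight of `L²_{x dx}` into the unweighted weak-derivative
identities. -/
lemma id_mul (h : IsTest L φ) : IsTest L (fun x => x * φ x) :=
  ⟨contDiff_id.mul h.smooth, h.compact.mul_left (f := fun x => x),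
    (tsupport_mul_subset_right (f := fun x => x)).trans h.supp⟩

lemma deriv_id_mul (h : IsTest L φ) :
    _root_.deriv (fun x => x * φ x) = fun x => x * _root_.deriv φ x + φ x := by
  ext x
  have := (hasDerivAt_id x).mul (h.hasDerivAt x)
  simp only [id, one_mul] at this
  rw [add_comm]
  exact this.deriv

lemma deriv_deriv_id_mul (h : IsTest L φ) :
    _root_.deriv (_root_.deriv (fun x => x * φ x)) =
      fun x => x * _root_.deriv (_root_.deriv φ) x + 2 * _root_.deriv φ x := by
  rw [h.deriv_id_mul]
  ext x
  have h1 := (hasDerivAt_id x).mul (h.deriv.hasDerivAt x)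
  simp only [id, one_mul] at h1
  refine ((h1.add (h.hasDerivAt x)).deriv).trans ?_
  ring

lemma eq_zero_of_notMem (h : IsTest L φ) {x : ℝ} (hx : x ∉ Ioo 0 L) : φ x = 0 :=
  image_eq_zero_of_notMem_tsupport fun hx' => hx (h.supp hx')

lemma memLp (h : IsTest L φ) (p : ℝ≥0∞) : MemLp φ p (volI L) :=
  (h.continuous.memLp_of_hasCompactSupport h.compact).restrict _

lemma exists_Ioo (hL : 0 < L) (h : IsTest L φ) :
    ∃ a b, 0 < a ∧ a < b ∧ b < L ∧ tsupport φ ⊆ Ioo a b := by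
  rcases (tsupport φ).eq_empty_or_nonempty with he | hne
  · exact ⟨L / 4, L / 2, by linarith, by linarith, by linarith, by simp [he]⟩
  have hc : IsCompact (tsupport φ) := h.compact
  obtain ⟨a, ha, ha'⟩ := hc.exists_isLeast hne
  obtain ⟨b, hb, hb'⟩ := hc.exists_isGreatest hne
  have h1 := h.supp ha
  have h2 := h.supp hb
  have h3 : a ≤ b := ha' hb
  refine ⟨a / 2, (b + L) / 2, by linarith [h1.1], by linarith [h1.1, h2.2], by linarith [h2.2],
    fun x hx => ⟨?_, ?_⟩⟩
  · linarith [ha' hx, h1.1]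
  · linarith [hb' hx, h2.2]

lemma integral_eq {f : ℝ → ℝ} {a b : ℝ} (ha : 0 < a) (hab : a < b) (hb : b < L)
    (h : tsupport φ ⊆ Ioo a b) : ∫ x in Ioo 0 L, f x * φ x = ∫ x in a..b, f x * φ x := by
  rw [intervalIntegral.integral_of_le hab.le, integral_Ioc_eq_integral_Ioo]
  have hz : ∀ x, x ∉ Ioo a b → f x * φ x = 0 := fun x hx => by
    rw [image_eq_zero_of_notMem_tsupport fun hx' => hx (h hx'), mul_zero]
  rw [setIntegral_eq_integral_of_forall_compl_eq_zero hz,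
    setIntegral_eq_integral_of_forall_compl_eq_zero]
  intro x hx
  exact hz x fun hx' => hx ⟨ha.trans hx'.1, hx'.2.trans hb⟩

lemma exists_integral_eq_one (hL : 0 < L) : ∃ ψ, IsTest L ψ ∧ ∫ x in Ioo 0 L, ψ x = 1 := by
  let f : ContDiffBump (L / 2) := ⟨L / 8, L / 4, by linarith, by linarith⟩
  have ht : tsupport (f.normed volume) ⊆ Ioo 0 L := by
    rw [f.tsupport_normed_eq, Real.closedBall_eq_Icc]
    intro x hx
    simp only [f, mem_Icc] at hx
    exact ⟨by linarith [hx.1], by linarith [hx.2]⟩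
  refine ⟨f.normed volume, ⟨f.contDiff_normed, f.hasCompactSupport_normed, ht⟩, ?_⟩
  rw [setIntegral_eq_integral_of_forall_compl_eq_zero, f.integral_normed]
  intro x hx
  exact image_eq_zero_of_notMem_tsupport fun hx' => hx (ht hx')

/-- The primitive from `0` vanishes to the left of the support of `ψ`, and to its right because `ψ`
has mean zero. -/
lemma exists_primitive (hL : 0 < L) (h : IsTest L ψ) (h0 : ∫ x in Ioo 0 L, ψ x = 0) :
    ∃ φ, IsTest L φ ∧ _root_.deriv φ = ψ := by
  obtain ⟨a, b, ha, hab, hb, hs⟩ := h.exists_Ioo hL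
  have hz : ∀ x, x ∉ Ioo a b → ψ x = 0 := fun x hx =>
    image_eq_zero_of_notMem_tsupport fun hx' => hx (hs hx')
  have hd : ∀ x, HasDerivAt (fun x => ∫ t in (0)..x, ψ t) (ψ x) x := fun x =>
    intervalIntegral.integral_hasDerivAt_right (h.continuous.intervalIntegrable _ _)
      h.continuous.aestronglyMeasurable.stronglyMeasurableAtFilter h.continuous.continuousAt
  have hderiv : _root_.deriv (fun x => ∫ t in (0)..x, ψ t) = ψ := funext fun x => (hd x).deriv
  have hout : ∀ x, x ∉ Icc a b → ∫ t in (0)..x, ψ t = 0 := by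
    intro x hx
    rcases lt_or_ge x a with hxa | hxa
    · rw [intervalIntegral.integral_congr (g := fun _ => 0), intervalIntegral.integral_zero]
      intro t ht
      refine hz t fun ht' => ?_
      rcases le_total 0 x with h1 | h1
      · rw [uIcc_of_le h1] at ht; linarith [ht.2, ht'.1]
      · rw [uIcc_of_ge h1] at ht; linarith [ht.2, ht'.1]
    · have hxb : b < x := not_le.1 fun hxb => hx ⟨hxa, hxb⟩
      rw [← intervalIntegral.integral_add_adjacent_intervals
        (h.continuous.intervalIntegrable 0 L) (h.continuous.intervalIntegrable L x),
        ← setIntegral_Ioo_eq hL.le, h0, zero_add,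
        intervalIntegral.integral_congr (g := fun _ => 0), intervalIntegral.integral_zero]
      intro t ht
      refine hz t fun ht' => ?_
      have := (mem_uIcc.1 ht)
      rcases this with h1 | h1 <;> linarith [ht'.2, h1.1]
  have hsupp : tsupport (fun x => ∫ t in (0)..x, ψ t) ⊆ Icc a b := by
    refine closure_minimal (fun x hx => ?_) isClosed_Icc
    by_contra hx'
    exact hx (hout x hx')
  refine ⟨_, ⟨?_, ?_, hsupp.trans fun x hx => ⟨ha.trans_le hx.1, hx.2.trans_lt hb⟩⟩, hderiv⟩
  · rw [contDiff_infty_iff_deriv, hderiv]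
    exact ⟨fun x => (hd x).differentiableAt, h.smooth⟩
  · exact isCompact_Icc.of_isClosed_subset (isClosed_tsupport _) hsupp

end IsTest

/-! ### Weak derivatives -/

lemma memLp_volI_of_continuous {L : ℝ} {f : ℝ → ℝ} (hf : Continuous f) (p : ℝ≥0∞) :
    MemLp f p (volI L) := by
  obtain ⟨C, hC⟩ := isCompact_Icc.exists_bound_of_continuousOn (s := Icc 0 L) hf.continuousOn
  refine MemLp.of_bound hf.aestronglyMeasurable C ?_
  filter_upwards [ae_restrict_mem measurableSet_Ioo] with x hx
  exact hC x (Ioo_subset_Icc_self hx)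

lemma MemLp.locallyIntegrableOn_Ioo {L : ℝ} {f : ℝ → ℝ} (hf : MemLp f 2 (volI L)) :
    LocallyIntegrableOn f (Ioo 0 L) := by
  have h : IntegrableOn f (Ioo 0 L) := hf.integrable (by norm_num)
  exact h.locallyIntegrableOn

lemma _root_.Continuous.locallyIntegrableOn {f : ℝ → ℝ} (hf : Continuous f) (s : Set ℝ) :
    LocallyIntegrableOn f s :=
  hf.locallyIntegrable.locallyIntegrableOn s

namespace HasWeakDeriv

variable {L : ℝ} {m n : ℕ} {u v g g' k : ℝ → ℝ}

lemma comp (h : HasWeakDeriv L m u g) (h' : HasWeakDeriv L n g k) :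
    HasWeakDeriv L (m + n) u k := by
  refine ⟨h.locInt, h'.locInt', fun φ hφ => ?_⟩
  rw [← iteratedDeriv_iteratedDeriv, h.integral_eq _ (hφ.iteratedDeriv n), h'.integral_eq φ hφ,
    pow_add]
  ring

/-- `MemSobolev` supplies the derivatives of `u` order by order, independently of each other. This
lemma makes the higher ones derivatives of the lower ones. -/
lemma of_comp (h : HasWeakDeriv L m u g) (h' : HasWeakDeriv L (m + n) u k) :
    HasWeakDeriv L n g k := by
  refine ⟨h.locInt', h'.locInt', fun φ hφ => ?_⟩
  have h1 := h.integral_eq _ (hφ.iteratedDeriv n)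
  rw [iteratedDeriv_iteratedDeriv, h'.integral_eq φ hφ, pow_add, mul_assoc] at h1
  exact (mul_left_cancel₀ (pow_ne_zero m (by norm_num)) h1).symm

lemma integral_deriv (h : HasWeakDeriv L 1 u g) {φ : ℝ → ℝ} (hφ : IsTest L φ) :
    ∫ x in Ioo 0 L, u x * deriv φ x = -∫ x in Ioo 0 L, g x * φ x := by
  simpa using h.integral_eq φ hφ

lemma integral_deriv_deriv (h : HasWeakDeriv L 2 u g) {φ : ℝ → ℝ} (hφ : IsTest L φ) :
    ∫ x in Ioo 0 L, u x * deriv (deriv φ) x = ∫ x in Ioo 0 L, g x * φ x := by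
  simpa [iteratedDeriv_succ] using h.integral_eq φ hφ

lemma sub (h : HasWeakDeriv L n u g) (h' : HasWeakDeriv L n v g') :
    HasWeakDeriv L n (u - v) (g - g') := by
  have := h.add (h'.smul (-1))
  rwa [neg_one_smul, neg_one_smul, ← sub_eq_add_neg, ← sub_eq_add_neg] at this

lemma self (h : LocallyIntegrableOn u (Ioo 0 L)) : HasWeakDeriv L 0 u u :=
  ⟨h, h, fun φ _ => by simp⟩

/-- Primitives of locally integrable functions are weakly differentiable. -/
lemma of_integral (hL : 0 < L) (hg : LocallyIntegrableOn g (Ioo 0 L))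
    (hu : ∀ x ∈ Ioo 0 L, ∀ y ∈ Ioo 0 L, u y - u x = ∫ t in x..y, g t) :
    HasWeakDeriv L 1 u g := by
  have hint : ∀ a b, 0 < a → a ≤ b → b < L → IntervalIntegrable g volume a b := by
    intro a b ha hab hb
    rw [intervalIntegrable_iff_integrableOn_Icc_of_le hab]
    exact hg.integrableOn_compact_subset (fun x hx => ⟨ha.trans_le hx.1, hx.2.trans_lt hb⟩)
      isCompact_Icc
  have hueq : ∀ a b, 0 < a → a ≤ b → b < L → ∀ x ∈ Icc a b, u x = u a + ∫ t in a..x, g t := by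
    intro a b ha hab hb x hx
    rw [← hu a ⟨ha, hab.trans_lt hb⟩ x ⟨ha.trans_le hx.1, hx.2.trans_lt hb⟩]
    ring
  have hac : ∀ a b, 0 < a → a ≤ b → b < L →
      AbsolutelyContinuousOnInterval (fun x => u a + ∫ t in a..x, g t) a b := by
    intro a b ha hab hb
    refine AbsolutelyContinuousOnInterval.add ?_
      ((hint a b ha hab hb).absolutelyContinuousOnInterval_intervalIntegral left_mem_uIcc)
    exact contDiffOn_const.absolutelyContinuousOnInterval
  refine ⟨?_, hg, fun φ hφ => ?_⟩
  · refine ContinuousOn.locallyIntegrableOn (fun x hx => ContinuousAt.continuousWithinAt ?_)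
      measurableSet_Ioo
    have h1 : 0 < x / 2 := by linarith [hx.1]
    have h2 : (x + L) / 2 < L := by linarith [hx.2]
    have h3 : x / 2 ≤ (x + L) / 2 := by linarith
    have hn : Icc (x / 2) ((x + L) / 2) ∈ 𝓝 x :=
      Icc_mem_nhds (by linarith [hx.1]) (by linarith [hx.2])
    have hc := (hac _ _ h1 h3 h2).continuousOn
    rw [uIcc_of_le h3] at hc
    refine (hc.continuousAt hn).congr ?_
    filter_upwards [hn] with y hy
    exact (hueq _ _ h1 h3 h2 y hy).symm
  · obtain ⟨a, b, ha, hab, hb, hs⟩ := hφ.exists_Ioo hL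
    -- Since `g` need not be integrable up to `0` or `L`, the absolutely continuous integration by
    -- parts is done on `[a, b]`, whose interior contains the support of `φ`.
    rw [iteratedDeriv_one, pow_one, neg_one_mul, IsTest.integral_eq ha hab hb hs,
      IsTest.integral_eq ha hab hb ((tsupport_deriv_subset ..).trans hs)]
    have h1 := (hac a b ha hab.le hb).integral_mul_deriv_eq_deriv_mul
      (g := φ) ((hφ.smooth.of_le
        (by exact_mod_cast le_top)).contDiffOn.absolutelyContinuousOnInterval)
    have hφa : φ a = 0 := image_eq_zero_of_notMem_tsupport fun h => lt_irrefl _ (hs h).1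
    have hφb : φ b = 0 := image_eq_zero_of_notMem_tsupport fun h => lt_irrefl _ (hs h).2
    rw [hφa, hφb, mul_zero, mul_zero, sub_zero, zero_sub] at h1
    have e1 : ∫ x in a..b, u x * _root_.deriv φ x
        = ∫ x in a..b, (u a + ∫ t in a..x, g t) * _root_.deriv φ x := by
      refine intervalIntegral.integral_congr fun x hx => ?_
      rw [uIcc_of_le hab.le] at hx
      simp only [hueq a b ha hab.le hb x hx]
    rw [e1, h1]
    congr 1
    refine intervalIntegral.integral_congr_ae ?_
    filter_upwards [(hint a b ha hab.le hb).ae_hasDerivAt_integral] with x hx hxm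
    rw [((hx (uIoc_subset_uIcc hxm) a left_mem_uIcc).const_add (u a)).deriv]

lemma eq_zero_of_zero (h : LocallyIntegrableOn u (Ioo 0 L))
    (h0 : ∀ φ, IsTest L φ → ∫ x in Ioo 0 L, u x * φ x = 0) : u =ᵐ[volI L] 0 :=
  unique (u := 0) (n := 0) ⟨locallyIntegrableOn_zero, h, fun φ hφ => by simp [h0 φ hφ]⟩
    (HasWeakDeriv.zero L 0)

/-- The **du Bois-Reymond lemma**. -/
lemma ae_eq_const (hL : 0 < L) (h : HasWeakDeriv L 1 u 0) : ∃ c, u =ᵐ[volI L] fun _ => c := by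
  obtain ⟨ψ, hψ, hψ1⟩ := IsTest.exists_integral_eq_one hL
  let c := ∫ x in Ioo 0 L, u x * ψ x
  refine ⟨c, ?_⟩
  have h0 : (u - fun _ => c) =ᵐ[volI L] 0 := by
    refine eq_zero_of_zero (h.locInt.sub (continuous_const.locallyIntegrableOn (Ioo 0 L)))
      fun φ hφ => ?_
    let m := ∫ x in Ioo 0 L, φ x
    have iφ : Integrable φ (volI L) := (hφ.memLp 1).integrable le_rfl
    have iψ : Integrable ψ (volI L) := (hψ.memLp 1).integrable le_rfl
    have iuφ : Integrable (fun x => u x * φ x) (volI L) :=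
      LocallyIntegrableOn.integrable_mul h.locInt hφ.continuous hφ.compact hφ.supp
    have iuψ : Integrable (fun x => u x * ψ x) (volI L) :=
      LocallyIntegrableOn.integrable_mul h.locInt hψ.continuous hψ.compact hψ.supp
    -- Subtracting `m ψ` makes the mean zero, so the difference is `χ'` for a test function `χ`.
    -- Testing with `χ` gives `∫ u φ = c m`.
    obtain ⟨χ, hχ, hχd⟩ := (hφ.sub (hψ.smul m)).exists_primitive hL (by
      simp only [Pi.sub_apply, Pi.smul_apply, smul_eq_mul]
      rw [integral_sub iφ (iψ.const_mul m), integral_const_mul, hψ1, mul_one, sub_self])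
    have h1 := h.integral_deriv hχ
    simp only [hχd, Pi.zero_apply, zero_mul, integral_zero, neg_zero, Pi.sub_apply, Pi.smul_apply,
      smul_eq_mul, mul_sub, mul_left_comm _ m] at h1
    rw [integral_sub iuφ (iuψ.const_mul m), integral_const_mul] at h1
    simp only [Pi.sub_apply, sub_mul]
    rw [integral_sub iuφ (iφ.const_mul c), integral_const_mul]
    linarith [mul_comm m c]
  filter_upwards [h0] with x hx
  exact sub_eq_zero.1 hx

lemma of_hasDerivAt (hL : 0 < L) (hg : Continuous g) (hu : ∀ x, HasDerivAt u (g x) x) :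
    HasWeakDeriv L 1 u g :=
  of_integral hL (hg.locallyIntegrableOn (Ioo 0 L)) fun x _ y _ =>
    (intervalIntegral.integral_eq_sub_of_hasDerivAt (fun t _ => hu t)
      (hg.intervalIntegrable x y)).symm

/-- The same mean-zero correction in the second-order identity shows that `u'` is a constant `d`.
Then the first-order result applies to `u - d x`. -/
lemma ae_eq_affine (hL : 0 < L) (h : HasWeakDeriv L 2 u 0) :
    ∃ c d, u =ᵐ[volI L] fun x => c + d * x := by
  obtain ⟨ψ, hψ, hψ1⟩ := IsTest.exists_integral_eq_one hL
  let d := -∫ x in Ioo 0 L, u x * _root_.deriv ψ x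
  have hd : HasWeakDeriv L 1 u (fun _ => d) := by
    refine ⟨h.locInt, continuous_const.locallyIntegrableOn (Ioo 0 L), fun φ hφ => ?_⟩
    let m := ∫ x in Ioo 0 L, φ x
    have iφ : Integrable φ (volI L) := (hφ.memLp 1).integrable le_rfl
    have iψ : Integrable ψ (volI L) := (hψ.memLp 1).integrable le_rfl
    have iuφ : Integrable (fun x => u x * _root_.deriv φ x) (volI L) :=
      LocallyIntegrableOn.integrable_mul h.locInt hφ.deriv.continuous hφ.deriv.compact
        hφ.deriv.supp
    have iuψ : Integrable (fun x => u x * _root_.deriv ψ x) (volI L) :=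
      LocallyIntegrableOn.integrable_mul h.locInt hψ.deriv.continuous hψ.deriv.compact
        hψ.deriv.supp
    obtain ⟨χ, hχ, hχd⟩ := (hφ.sub (hψ.smul m)).exists_primitive hL (by
      simp only [Pi.sub_apply, Pi.smul_apply, smul_eq_mul]
      rw [integral_sub iφ (iψ.const_mul m), integral_const_mul, hψ1, mul_one, sub_self])
    have h1 := h.integral_deriv_deriv hχ
    have e : _root_.deriv (φ - m • ψ) = fun x => _root_.deriv φ x - m * _root_.deriv ψ x := by
      ext x
      exact ((hφ.hasDerivAt x).sub ((hψ.hasDerivAt x).const_smul m)).deriv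
    simp only [hχd, e, Pi.zero_apply, zero_mul, integral_zero, mul_sub, mul_left_comm _ m] at h1
    rw [integral_sub iuφ (iuψ.const_mul m), integral_const_mul] at h1
    rw [iteratedDeriv_one, pow_one, integral_const_mul]
    linarith [mul_comm m d]
  have hx : HasWeakDeriv L 1 (fun x => d * x) (fun _ => d) :=
    of_hasDerivAt hL continuous_const fun x => by simpa using (hasDerivAt_id x).const_mul d
  have h0 := hd.sub hx
  rw [sub_self] at h0
  obtain ⟨c, hc⟩ := h0.ae_eq_const hL
  refine ⟨c, d, ?_⟩
  filter_upwards [hc] with x hx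
  rw [← hx, Pi.sub_apply]
  ring

/-- A weakly differentiable function with integrable derivative is, up to a null set,
a primitive of it. -/
lemma ae_eq_integral (hL : 0 < L) (h : HasWeakDeriv L 1 u g) (hg : IntegrableOn g (Ioo 0 L)) :
    ∃ c, u =ᵐ[volI L] fun x => c + ∫ t in L..x, g t := by
  have hg' : IntegrableOn g (Icc 0 L) := by rwa [integrableOn_Icc_iff_integrableOn_Ioo]
  have hint : ∀ x ∈ Icc 0 L, IntervalIntegrable g volume L x := fun x hx => by
    rw [intervalIntegrable_iff, uIoc_of_ge hx.2]
    exact hg'.mono_set (Ioc_subset_Icc_self.trans (Icc_subset_Icc_left hx.1))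
  have h1 : HasWeakDeriv L 1 (fun x => ∫ t in L..x, g t) g :=
    of_integral hL h.locInt' fun x hx y hy =>
      intervalIntegral.integral_interval_sub_left (hint y (Ioo_subset_Icc_self hy))
        (hint x (Ioo_subset_Icc_self hx))
  have h0 := h.sub h1
  rw [sub_self] at h0
  obtain ⟨c, hc⟩ := h0.ae_eq_const hL
  refine ⟨c, ?_⟩
  filter_upwards [hc] with x hx
  rw [← hx, Pi.sub_apply]
  ring

end HasWeakDeriv

open scoped InnerProductSpace

/-! ### Integrals of products of square integrable functions -/

section L2

variable {X : Type*} [MeasurableSpace X] {μ : Measure X} {f g : X → ℝ}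

lemma integrable_mul_of_memLp (hf : MemLp f 2 μ) (hg : MemLp g 2 μ) :
    Integrable (fun x => f x * g x) μ :=
  hf.integrable_mul hg

lemma inner_toLp_eq (hf : MemLp f 2 μ) (hg : MemLp g 2 μ) :
    ⟪hf.toLp f, hg.toLp g⟫_ℝ = ∫ x, f x * g x ∂μ := by
  rw [L2.inner_def]
  refine integral_congr_ae ?_
  filter_upwards [hf.coeFn_toLp, hg.coeFn_toLp] with x h1 h2
  rw [h1, h2]
  simp [mul_comm]

lemma sq_integral_mul_le (hf : MemLp f 2 μ) (hg : MemLp g 2 μ) :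
    (∫ x, f x * g x ∂μ) ^ 2 ≤ (∫ x, f x * f x ∂μ) * ∫ x, g x * g x ∂μ := by
  rw [← inner_toLp_eq hf hg, ← inner_toLp_eq hf hf, ← inner_toLp_eq hg hg, sq]
  exact real_inner_mul_inner_self_le _ _

lemma tendsto_integral_mul_of_eLpNorm {ψ : ℕ → X → ℝ} (hf : MemLp f 2 μ) (hg : MemLp g 2 μ)
    (hψ : ∀ m, MemLp (ψ m) 2 μ)
    (h : Tendsto (fun m => eLpNorm (fun x => g x - ψ m x) 2 μ) atTop (𝓝 0)) :
    Tendsto (fun m => ∫ x, f x * ψ m x ∂μ) atTop (𝓝 (∫ x, f x * g x ∂μ)) := by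
  have h1 : Tendsto (fun m => (hψ m).toLp (ψ m)) atTop (𝓝 (hg.toLp g)) := by
    rw [Lp.tendsto_Lp_iff_tendsto_eLpNorm'']
    refine h.congr fun m => ?_
    rw [← eLpNorm_neg]
    congr 1
    ext x
    simp
  simpa only [inner_toLp_eq] using
    Filter.Tendsto.inner (𝕜 := ℝ) (tendsto_const_nhds (x := hf.toLp f)) h1

end L2

variable {L : ℝ}

lemma MemLp.id_mul {f : ℝ → ℝ} (hf : MemLp f 2 (volI L)) :
    MemLp (fun x => x * f x) 2 (volI L) := by
  refine hf.of_le_mul (c := L) (continuous_id.aestronglyMeasurable.mul hf.1) ?_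
  filter_upwards [ae_restrict_mem measurableSet_Ioo] with x hx
  rw [norm_mul, Real.norm_of_nonneg hx.1.le]
  exact mul_le_mul_of_nonneg_right hx.2.le (norm_nonneg _)

lemma integral_xMeasure (f : ℝ → ℝ) :
    ∫ x, f x ∂xMeasure L = ∫ x in Ioo 0 L, x * f x := by
  rw [xMeasure, integral_withDensity_eq_integral_toReal_smul (by fun_prop)
    (Eventually.of_forall fun x => ENNReal.ofReal_lt_top)]
  refine setIntegral_congr_fun measurableSet_Ioo fun x hx => ?_
  simp [ENNReal.toReal_ofReal hx.1.le]

lemma eLpNorm_xMeasure_le (f : ℝ → ℝ) :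
    eLpNorm f 2 (xMeasure L) ≤ ENNReal.ofReal L ^ (1 / 2 : ℝ) * eLpNorm f 2 (volI L) := by
  refine (eLpNorm_mono_measure f (xMeasure_le L)).trans ?_
  rw [eLpNorm_smul_measure_of_ne_top (by norm_num)]
  simp

/-! ### Energy identities and quasi-dissipativity of `-A₁` -/

/-- Test functions approximating `u ∈ H²₀(0, L)`, tested against square integrable functions. -/
lemma MemH20.exists_approx {u g₁ g₂ : ℝ → ℝ} (h : MemH20 L u) (hu : MemLp u 2 (volI L))
    (h1 : HasWeakDeriv L 1 u g₁) (h2 : HasWeakDeriv L 2 u g₂)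
    (hg1 : MemLp g₁ 2 (volI L)) (hg2 : MemLp g₂ 2 (volI L)) :
    ∃ φ : ℕ → ℝ → ℝ, (∀ m, IsTest L (φ m)) ∧
      (∀ f, MemLp f 2 (volI L) → Tendsto (fun m => ∫ x in Ioo 0 L, f x * φ m x) atTop
        (𝓝 (∫ x in Ioo 0 L, f x * u x))) ∧
      (∀ f, MemLp f 2 (volI L) → Tendsto (fun m => ∫ x in Ioo 0 L, f x * deriv (φ m) x) atTop
        (𝓝 (∫ x in Ioo 0 L, f x * g₁ x))) ∧
      (∀ f, MemLp f 2 (volI L) →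
        Tendsto (fun m => ∫ x in Ioo 0 L, f x * deriv (deriv (φ m)) x) atTop
        (𝓝 (∫ x in Ioo 0 L, f x * g₂ x))) ∧
      (∀ f, MemLp f 2 (xMeasure L) → Tendsto (fun m => ∫ x, f x * φ m x ∂xMeasure L) atTop
        (𝓝 (∫ x, f x * u x ∂xMeasure L))) := by
  obtain ⟨-, φ, hφ, hl⟩ := h
  have l0 := hl 0 (by norm_num) u (HasWeakDeriv.self h1.locInt)
  have l1 := hl 1 (by norm_num) g₁ h1
  have l2 := hl 2 le_rfl g₂ h2
  simp only [iteratedDeriv_zero] at l0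
  simp only [iteratedDeriv_one] at l1
  simp only [iteratedDeriv_succ, iteratedDeriv_zero] at l2
  refine ⟨φ, hφ, fun f hf => tendsto_integral_mul_of_eLpNorm hf hu (fun m => (hφ m).memLp 2) l0,
    fun f hf => tendsto_integral_mul_of_eLpNorm hf hg1 (fun m => (hφ m).deriv.memLp 2) l1,
    fun f hf => tendsto_integral_mul_of_eLpNorm hf hg2 (fun m => (hφ m).deriv.deriv.memLp 2) l2,
    fun f hf => tendsto_integral_mul_of_eLpNorm hf (MemLp.xMeasure_of_volI hu)
      (fun m => MemLp.xMeasure_of_volI ((hφ m).memLp 2)) ?_⟩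
  have l3 := ENNReal.Tendsto.const_mul (a := ENNReal.ofReal L ^ (1 / 2 : ℝ)) l0
    (Or.inr (by simp))
  rw [mul_zero] at l3
  exact tendsto_of_tendsto_of_tendsto_of_le_of_le tendsto_const_nhds l3 (fun _ => zero_le)
    fun m => eLpNorm_xMeasure_le _

/-- `2 ∫ x w w' = - ∫ w²` if `w(L) = 0`. -/
lemma integral_id_mul_mul_of_trace (hL : 0 < L) {w g : ℝ → ℝ} (h : HasWeakDeriv L 1 w g)
    (hg : MemLp g 2 (volI L)) (hw : ContinuousOn w (Icc 0 L)) (hwL : w L = 0) :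
    2 * ∫ x in Ioo 0 L, x * w x * g x = -∫ x in Ioo 0 L, w x * w x := by
  have hgi : IntegrableOn g (Ioo 0 L) := hg.integrable (by norm_num)
  have hint : IntervalIntegrable g volume 0 L := by
    rwa [intervalIntegrable_iff_integrableOn_Ioo_of_le hL.le]
  obtain ⟨c, hc⟩ := h.ae_eq_integral hL hgi
  let W : ℝ → ℝ := fun x => c + ∫ t in L..x, g t
  have hWac : AbsolutelyContinuousOnInterval W 0 L :=
    (contDiffOn_const.absolutelyContinuousOnInterval).add
      (hint.absolutelyContinuousOnInterval_intervalIntegral right_mem_uIcc)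
  have hWc : ContinuousOn W (Icc 0 L) := by
    simpa only [uIcc_of_le hL.le] using hWac.continuousOn
  have heq : EqOn w W (Icc 0 L) := by
    refine Measure.eqOn_Icc_of_ae_eq volume hL.ne ?_ hw hWc
    rw [← restrict_Ioo_eq_restrict_Icc]
    exact hc
  have hWL : W L = 0 := by rw [← heq (right_mem_Icc.2 hL.le), hwL]
  have hid : AbsolutelyContinuousOnInterval (fun x : ℝ => x) 0 L :=
    contDiffOn_id.absolutelyContinuousOnInterval
  -- The function `x W²` vanishes at both endpoints, at `0` thanks to the weight alone, so the
  -- integral of its derivative is zero.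
  have hP : AbsolutelyContinuousOnInterval (fun x => x * (W x * W x)) 0 L :=
    hid.mul (hWac.mul hWac)
  have h1 := hP.integral_deriv_eq_sub
  rw [hWL] at h1
  simp only [mul_zero, zero_mul, sub_zero] at h1
  have h2 : ∫ x in (0)..L, deriv (fun x => x * (W x * W x)) x
      = ∫ x in (0)..L, W x * W x + 2 * (x * W x * g x) := by
    refine intervalIntegral.integral_congr_ae ?_
    filter_upwards [hint.ae_hasDerivAt_integral] with x hx hxm
    have hd : HasDerivAt W (g x) x :=
      (hx (uIoc_subset_uIcc hxm) L right_mem_uIcc).const_add c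
    have := ((hasDerivAt_id x).mul (hd.mul hd)).deriv
    refine this.trans ?_
    simp only [id, Pi.mul_apply]
    ring
  have hwm : MemLp w 2 (volI L) := by
    obtain ⟨C, hC⟩ := isCompact_Icc.exists_bound_of_continuousOn hw
    refine MemLp.of_bound h.locInt.aestronglyMeasurable C ?_
    filter_upwards [ae_restrict_mem measurableSet_Ioo] with x hx
    exact hC x (Ioo_subset_Icc_self hx)
  rw [h2, ← setIntegral_Ioo_eq hL.le] at h1
  have h3 : ∫ x in Ioo 0 L, W x * W x + 2 * (x * W x * g x)
      = ∫ x in Ioo 0 L, w x * w x + 2 * (x * w x * g x) :=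
    setIntegral_congr_fun measurableSet_Ioo fun x hx => by
      simp only [heq (Ioo_subset_Icc_self hx)]
  rw [h3, integral_add (integrable_mul_of_memLp hwm hwm)
    ((integrable_mul_of_memLp (MemLp.id_mul hwm) hg).const_mul 2), integral_const_mul] at h1
  linarith

/-- The inequality behind the quasi-dissipativity of `-A₁`. -/
lemma quasidissipative_bound (hL : 0 < L) {a b₀ b₁ b₂ p q : ℝ} (ha : 0 ≤ a) (hb0 : 0 ≤ b₀)
    (hb1 : 0 ≤ b₁) (hb2 : 0 ≤ b₂) (h1 : b₁ ^ 2 ≤ b₀ * b₂) (h0 : b₀ ^ 2 ≤ 4 * (a * (L * b₁)))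
    (hp : p ^ 2 ≤ b₂ * b₀) (hq : q ^ 2 ≤ L ^ 2 * b₁ * b₂) :
    -(5 / 2) * b₂ - p - q ≤ (L * (2 + L ^ 2) ^ 3) * a := by
  -- Here `a, b₀, b₁, b₂` stand for `∫ x u²`, `∫ u²`, `∫ u_x²`, `∫ u_xx²`, and `p, q` for `∫ u_xx
  -- u`, `∫ x u_xx u_x`. Young's inequality turns each product bound into a linear one. First `-p -
  -- q ≤ b₂ + b₀/2 + L² b₁/2`; then weights depending on `s ≥ 1 + L²` absorb the `b₀` and `b₁` terms
  -- into one more `b₂` and a multiple of `a`, for a total of `2 b₂ ≤ (5/2) b₂`.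
  set s := 2 + L ^ 2 with hs
  have hs2 : 2 ≤ s := by nlinarith
  have hp' : -p ≤ b₂ / 2 + b₀ / 2 := by
    refine le_of_abs_le (abs_le_of_sq_le_sq ?_ (by positivity))
    nlinarith [sq_nonneg (b₂ - b₀)]
  have hq' : -q ≤ b₂ / 2 + L ^ 2 * b₁ / 2 := by
    refine le_of_abs_le (abs_le_of_sq_le_sq ?_ (by positivity))
    nlinarith [sq_nonneg (b₂ - L ^ 2 * b₁)]
  have h0' : s * b₀ ≤ 2 * b₁ + s ^ 2 * (L * a) / 2 := by
    refine le_of_abs_le (abs_le_of_sq_le_sq ?_ (by positivity))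
    have h2 : s ^ 2 * b₀ ^ 2 ≤ s ^ 2 * (4 * (a * (L * b₁))) := by gcongr
    nlinarith [sq_nonneg (2 * b₁ - s ^ 2 * (L * a) / 2)]
  have h1' : s * b₁ ≤ b₂ + s ^ 2 * b₀ / 4 := by
    refine le_of_abs_le (abs_le_of_sq_le_sq ?_ (by positivity))
    have h2 : s ^ 2 * b₁ ^ 2 ≤ s ^ 2 * (b₀ * b₂) := by gcongr
    nlinarith [sq_nonneg (b₂ - s ^ 2 * b₀ / 4)]
  have h2' : s * b₁ ≤ 2 * b₂ + s ^ 3 * (L * a) / 4 := by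
    have : s * (s * b₀) ≤ s * (2 * b₁ + s ^ 2 * (L * a) / 2) := by gcongr
    nlinarith
  have h3' : b₀ ≤ b₁ + s * (L * a) / 2 := by
    have : s * b₀ ≤ s * (b₁ + s * (L * a) / 2) := by nlinarith
    exact le_of_mul_le_mul_left this (by linarith)
  have hLa : 0 ≤ L * a := by positivity
  have h4 : s * (L * a) ≤ s ^ 3 * (L * a) := by
    gcongr
    nlinarith [sq_nonneg s]
  have h5 : L ^ 2 * b₁ = s * b₁ - 2 * b₁ := by rw [hs]; ring
  nlinarith

/-- One factor `u` is replaced by test functions converging in `H²`, so no boundary terms in `u` or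
`u_x` arise. The fifth derivative is only in the weighted space, so its pairing with `u` needs
weighted convergence. The trace condition enters only in `∫ x u_xxx u_xx`. -/
lemma MemDomain.integral_le (hL : 0 < L) {u g₃ g₅ : ℝ → ℝ} (h : MemDomain L u)
    (h5 : HasWeakDeriv L 5 u g₅) (h3 : HasWeakDeriv L 3 u g₃) (hg5 : MemLp g₅ 2 (xMeasure L))
    (hg3 : MemLp g₃ 2 (volI L)) :
    ∫ x, (g₅ x + g₃ x) * u x ∂xMeasure L ≤
      (L * (2 + L ^ 2) ^ 3) * ∫ x, u x * u x ∂xMeasure L := by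
  obtain ⟨g₀, h0, hg0⟩ := h.sobolev 0 (by norm_num)
  obtain ⟨g₁, h1, hg1⟩ := h.sobolev 1 (by norm_num)
  obtain ⟨g₂, h2, hg2⟩ := h.sobolev 2 (by norm_num)
  have hu : MemLp u 2 (volI L) :=
    (memLp_congr_ae (h0.unique (HasWeakDeriv.self h0.locInt))).1 hg0
  have h12 : HasWeakDeriv L 1 g₁ g₂ := h1.of_comp h2
  have h23 : HasWeakDeriv L 1 g₂ g₃ := h2.of_comp h3
  have h35 : HasWeakDeriv L 2 g₃ g₅ := h3.of_comp h5
  have hxu := MemLp.id_mul hu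
  have hx1 := MemLp.id_mul hg1
  have hx2 := MemLp.id_mul hg2
  have hx3 := MemLp.id_mul hg3
  obtain ⟨φ, hφ, l0, l1, l2, lx⟩ := h.h20.exists_approx hu h1 h2 hg1 hg2
  have i : ∀ {f g : ℝ → ℝ}, MemLp f 2 (volI L) → MemLp g 2 (volI L) →
      Integrable (fun x => f x * g x) (volI L) := fun hf hg => integrable_mul_of_memLp hf hg
  -- `∫ u u_xx = - ∫ u_x²`
  have e1 : ∫ x in Ioo 0 L, u x * g₂ x = -∫ x in Ioo 0 L, g₁ x * g₁ x := by
    refine tendsto_nhds_unique (l2 u hu) ((l1 g₁ hg1).neg.congr fun m => ?_)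
    exact (h1.integral_deriv (hφ m).deriv).symm
  -- `∫ u² = - 2 ∫ x u u_x`
  have e2 : ∫ x in Ioo 0 L, u x * u x = -2 * ∫ x in Ioo 0 L, x * u x * g₁ x := by
    have key : ∫ x in Ioo 0 L, x * u x * g₁ x
        = -(∫ x in Ioo 0 L, u x * u x) - ∫ x in Ioo 0 L, x * g₁ x * u x := by
      refine tendsto_nhds_unique (l1 _ hxu) (((l0 u hu).neg.sub (l0 _ hx1)).congr fun m => ?_)
      have hm := (hφ m).memLp (2 : ℝ≥0∞)
      have hm' := (hφ m).deriv.memLp (2 : ℝ≥0∞)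
      have := h1.integral_deriv (hφ m).id_mul
      simp only [(hφ m).deriv_id_mul] at this
      have s1 : ∫ x in Ioo 0 L, u x * (x * deriv (φ m) x + φ m x)
          = (∫ x in Ioo 0 L, x * u x * deriv (φ m) x) + ∫ x in Ioo 0 L, u x * φ m x := by
        rw [← integral_add (i hxu hm') (i hu hm)]
        congr 1; ext x; ring
      have s2 : ∫ x in Ioo 0 L, g₁ x * (x * φ m x) = ∫ x in Ioo 0 L, x * g₁ x * φ m x := by
        congr 1; ext x; ring
      rw [s1, s2] at this
      linarith
    have s3 : ∫ x in Ioo 0 L, x * g₁ x * u x = ∫ x in Ioo 0 L, x * u x * g₁ x := by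
      congr 1; ext x; ring
    linarith
  -- `∫ u_xxx u_x = - ∫ u_xx²`
  have e3 : ∫ x in Ioo 0 L, g₃ x * g₁ x = -∫ x in Ioo 0 L, g₂ x * g₂ x := by
    refine tendsto_nhds_unique (l1 g₃ hg3) ((l2 g₂ hg2).neg.congr fun m => ?_)
    rw [h23.integral_deriv (hφ m).deriv, neg_neg]
  -- `∫ x u_xxx u = - ∫ u_xx (x u_x + u)`
  have e4 : ∫ x in Ioo 0 L, x * g₃ x * u x
      = -(∫ x in Ioo 0 L, x * g₂ x * g₁ x) - ∫ x in Ioo 0 L, g₂ x * u x := by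
    refine tendsto_nhds_unique (l0 _ hx3) (((l1 _ hx2).neg.sub (l0 _ hg2)).congr fun m => ?_)
    have hm := (hφ m).memLp (2 : ℝ≥0∞)
    have hm' := (hφ m).deriv.memLp (2 : ℝ≥0∞)
    have := h23.integral_deriv (hφ m).id_mul
    simp only [(hφ m).deriv_id_mul] at this
    have s1 : ∫ x in Ioo 0 L, g₂ x * (x * deriv (φ m) x + φ m x)
        = (∫ x in Ioo 0 L, x * g₂ x * deriv (φ m) x) + ∫ x in Ioo 0 L, g₂ x * φ m x := by
      rw [← integral_add (i hx2 hm') (i hg2 hm)]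
      congr 1; ext x; ring
    have s2 : ∫ x in Ioo 0 L, g₃ x * (x * φ m x) = ∫ x in Ioo 0 L, x * g₃ x * φ m x := by
      congr 1; ext x; ring
    rw [s1, s2] at this
    linarith
  -- `∫ x u_xxxxx u = ∫ u_xxx (x u_xx + 2 u_x)`
  have e5 : ∫ x, g₅ x * u x ∂xMeasure L
      = (∫ x in Ioo 0 L, x * g₃ x * g₂ x) + 2 * ∫ x in Ioo 0 L, g₃ x * g₁ x := by
    refine tendsto_nhds_unique (lx g₅ hg5)
      (((l2 _ hx3).add ((l1 g₃ hg3).const_mul 2)).congr fun m => ?_)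
    have hm' := (hφ m).deriv.memLp (2 : ℝ≥0∞)
    have hm'' := (hφ m).deriv.deriv.memLp (2 : ℝ≥0∞)
    have := h35.integral_deriv_deriv (hφ m).id_mul
    simp only [(hφ m).deriv_deriv_id_mul] at this
    have s1 : ∫ x in Ioo 0 L, g₃ x * (x * deriv (deriv (φ m)) x + 2 * deriv (φ m) x)
        = (∫ x in Ioo 0 L, x * g₃ x * deriv (deriv (φ m)) x)
          + 2 * ∫ x in Ioo 0 L, g₃ x * deriv (φ m) x := by
      rw [← integral_const_mul, ← integral_add (i hx3 hm'') ((i hg3 hm').const_mul 2)]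
      congr 1; ext x; ring
    rw [← s1, this, integral_xMeasure]
    congr 1; ext x; ring
  -- `∫ x u_xxx u_xx = - (1/2) ∫ u_xx²`
  have e6 : 2 * ∫ x in Ioo 0 L, x * g₃ x * g₂ x = -∫ x in Ioo 0 L, g₂ x * g₂ x := by
    obtain ⟨v, hv, hvc, hvL⟩ := h.trace
    have hae := hv.unique h2
    have h := integral_id_mul_mul_of_trace hL (h23.congr hae.symm .rfl) hg3 hvc hvL
    have s1 : ∫ x in Ioo 0 L, x * g₃ x * g₂ x = ∫ x in Ioo 0 L, x * v x * g₃ x :=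
      integral_congr_ae (by filter_upwards [hae] with x hx; rw [hx]; ring)
    have s2 : ∫ x in Ioo 0 L, g₂ x * g₂ x = ∫ x in Ioo 0 L, v x * v x :=
      integral_congr_ae (by filter_upwards [hae] with x hx; rw [hx])
    rw [s1, s2, h]
  have hsum : ∫ x, (g₅ x + g₃ x) * u x ∂xMeasure L
      = -(5 / 2) * (∫ x in Ioo 0 L, g₂ x * g₂ x) - (∫ x in Ioo 0 L, g₂ x * u x)
        - ∫ x in Ioo 0 L, x * g₂ x * g₁ x := by
    have hux := MemLp.xMeasure_of_volI hu
    have s1 : ∫ x, g₃ x * u x ∂xMeasure L = ∫ x in Ioo 0 L, x * g₃ x * u x := by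
      rw [integral_xMeasure]
      congr 1; ext x; ring
    have s2 : ∫ x, (g₅ x + g₃ x) * u x ∂xMeasure L
        = ∫ x, g₅ x * u x + g₃ x * u x ∂xMeasure L := by
      congr 1; ext x; ring
    rw [s2, integral_add (integrable_mul_of_memLp hg5 hux)
      (integrable_mul_of_memLp (MemLp.xMeasure_of_volI hg3) hux), s1, e5, e4, e3]
    linarith
  have hnn : ∀ f : ℝ → ℝ, 0 ≤ ∫ x in Ioo 0 L, f x * f x := fun f =>
    integral_nonneg fun x => mul_self_nonneg _
  have hidsq : ∫ x in Ioo 0 L, (x * g₁ x) * (x * g₁ x) ≤ L ^ 2 * ∫ x in Ioo 0 L, g₁ x * g₁ x := by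
    rw [← integral_const_mul]
    refine setIntegral_mono_on (i hx1 hx1) ((i hg1 hg1).const_mul _) measurableSet_Ioo
      fun x hx => ?_
    have : x ^ 2 ≤ L ^ 2 := by
      have := hx.1
      have := hx.2
      gcongr
    nlinarith [mul_self_nonneg (g₁ x)]
  have hxle : ∫ x, g₁ x * g₁ x ∂xMeasure L ≤ L * ∫ x in Ioo 0 L, g₁ x * g₁ x := by
    rw [← integral_const_mul, integral_xMeasure]
    refine setIntegral_mono_on ?_ ((i hg1 hg1).const_mul _) measurableSet_Ioo
      fun x hx => mul_le_mul_of_nonneg_right hx.2.le (mul_self_nonneg _)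
    refine (i hx1 hg1).congr (Eventually.of_forall fun x => ?_)
    simp only [mul_assoc]
  have hxnn : 0 ≤ ∫ x, u x * u x ∂xMeasure L := integral_nonneg fun x => mul_self_nonneg _
  rw [hsum]
  refine quasidissipative_bound hL hxnn (hnn u) (hnn g₁) (hnn g₂) ?_ ?_ ?_ ?_
  · have := sq_integral_mul_le hu hg2
    rwa [e1, neg_sq] at this
  -- Cauchy–Schwarz is used in the weighted space, and only then `x ≤ L` on the factor `u_x`, so
  -- that the other factor remains `∫ x u²`.
  · have h6 := sq_integral_mul_le (MemLp.xMeasure_of_volI hu) (MemLp.xMeasure_of_volI hg1)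
    have s1 : ∫ x in Ioo 0 L, x * u x * g₁ x = ∫ x, u x * g₁ x ∂xMeasure L := by
      rw [integral_xMeasure]
      congr 1; ext x; ring
    rw [e2, s1, mul_pow]
    have h7 := mul_le_mul_of_nonneg_left hxle hxnn
    linarith
  · exact sq_integral_mul_le hg2 hu
  · have h6 := sq_integral_mul_le hg2 hx1
    have s1 : ∫ x in Ioo 0 L, g₂ x * (x * g₁ x) = ∫ x in Ioo 0 L, x * g₂ x * g₁ x := by
      congr 1; ext x; ring
    rw [s1] at h6
    have h7 := mul_le_mul_of_nonneg_left hidsq (hnn g₂)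
    linarith

theorem quasidissipative_neg_A₁ (hL : 0 < L) (u : (-A₁ L).domain) :
    ⟪(-A₁ L) u, (u : L2x L)⟫_ℝ ≤ (L * (2 + L ^ 2) ^ 3) * ‖(u : L2x L)‖ ^ 2 := by
  have hu : MemDomain L (u : L2x L) := u.2
  obtain ⟨g₅, hg5, hg5'⟩ := hu.fifth
  obtain ⟨g₃, hg3, hg3'⟩ := hu.sobolev 3 (by norm_num)
  have h := hu.integral_le hL hg5 hg3 hg5' hg3'
  have e1 : ⟪(-A₁ L) u, (u : L2x L)⟫_ℝ
      = ∫ x, (g₅ x + g₃ x) * (u : L2x L) x ∂xMeasure L := by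
    rw [L2.inner_def]
    refine integral_congr_ae ?_
    have e : ((-A₁ L) u : L2x L) = -(hu.memLp_exprA₁.toLp _) := rfl
    rw [e]
    filter_upwards [Lp.coeFn_neg (hu.memLp_exprA₁.toLp _), hu.memLp_exprA₁.coeFn_toLp,
      exprA₁_ae hg5 hg3] with x h1 h2 h3
    rw [h1, Pi.neg_apply, h2, h3]
    simp only [RCLike.inner_apply, conj_trivial]
    ring
  have e2 : ‖(u : L2x L)‖ ^ 2 = ∫ x, (u : L2x L) x * (u : L2x L) x ∂xMeasure L := by
    rw [← real_inner_self_eq_norm_sq, L2.inner_def]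
    rfl
  rw [e1, e2]
  exact h

/-! ### Characterization of `H²₀(0, L)` by boundary values -/

/-- Poincaré inequality: `|f|` is at most the `L¹` norm of `f'`. Passing from `L¹` to `L²` on the
right and from the supremum to `L²` on the left costs `L^{1/2}` each. -/
lemma eLpNorm_le_eLpNorm_deriv (hL : 0 < L) {f f' : ℝ → ℝ} (hf : ∀ x, HasDerivAt f (f' x) x)
    (hf' : Continuous f') (h0 : f 0 = 0) :
    eLpNorm f 2 (volI L) ≤ ENNReal.ofReal L * eLpNorm f' 2 (volI L) := by
  have huniv : (volI L) univ = ENNReal.ofReal L := by simp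
  have h1 : ∀ᵐ x ∂volI L, ‖f x‖ₑ ≤ eLpNorm f' 1 (volI L) := by
    filter_upwards [ae_restrict_mem measurableSet_Ioo] with x hx
    have h2 : f x = ∫ t in Ioc 0 x, f' t := by
      rw [← intervalIntegral.integral_of_le hx.1.le,
        intervalIntegral.integral_eq_sub_of_hasDerivAt (fun t _ => hf t)
          (hf'.intervalIntegrable _ _), h0, sub_zero]
    rw [h2, eLpNorm_one_eq_lintegral_enorm]
    refine (enorm_integral_le_lintegral_enorm _).trans (lintegral_mono_set fun t ht => ?_)
    exact ⟨ht.1, ht.2.trans_lt hx.2⟩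
  have h3 := eLpNorm_le_of_ae_enorm_bound (p := 2) h1
  have h4 := eLpNorm_le_eLpNorm_mul_rpow_measure_univ (p := 1) (q := 2) (μ := volI L)
    (by norm_num) hf'.aestronglyMeasurable
  rw [huniv] at h3 h4
  refine h3.trans ?_
  have e : ENNReal.ofReal L = ENNReal.ofReal L ^ (2⁻¹ : ℝ) * ENNReal.ofReal L ^ (2⁻¹ : ℝ) := by
    rw [← ENNReal.rpow_add _ _ (by simpa using hL) ENNReal.ofReal_ne_top]
    norm_num
  have e1 : (1 / (1 : ℝ≥0∞).toReal - 1 / (2 : ℝ≥0∞).toReal : ℝ) = 2⁻¹ := by norm_num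
  have e2 : ((2 : ℝ≥0∞).toReal⁻¹ : ℝ) = 2⁻¹ := by norm_num
  rw [e1] at h4
  rw [smul_eq_mul, e2, e, ← e]
  calc _ ≤ eLpNorm f' 2 (volI L) * ENNReal.ofReal L ^ (2⁻¹ : ℝ) *
        ENNReal.ofReal L ^ (2⁻¹ : ℝ) := by gcongr
    _ = ENNReal.ofReal L * eLpNorm f' 2 (volI L) := by
      conv_rhs => rw [e]
      ring

lemma IsTest.iteratedDeriv_add {φ ψ : ℝ → ℝ} (hφ : IsTest L φ) (hψ : IsTest L ψ) (n : ℕ) (x : ℝ) :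
    _root_.iteratedDeriv n (φ + ψ) x
      = _root_.iteratedDeriv n φ x + _root_.iteratedDeriv n ψ x :=
  _root_.iteratedDeriv_add (hφ.smooth.contDiffAt.of_le (by exact_mod_cast le_top))
    (hψ.smooth.contDiffAt.of_le (by exact_mod_cast le_top))

/-- The second derivatives of test functions, as a subspace of `L²(0, L)`. -/
def testSecondDerivs (L : ℝ) : Submodule ℝ (Lp ℝ 2 (volI L)) where
  carrier := {f | ∃ φ, IsTest L φ ∧ f =ᵐ[volI L] iteratedDeriv 2 φ}
  zero_mem' := ⟨0, IsTest.zero L, by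
    refine (Lp.coeFn_zero ℝ 2 (volI L)).trans (Eventually.of_forall fun x => ?_)
    simp [Pi.zero_def]⟩
  add_mem' := by
    rintro f g ⟨φ, hφ, hf⟩ ⟨ψ, hψ, hg⟩
    refine ⟨φ + ψ, hφ.add hψ, ?_⟩
    filter_upwards [Lp.coeFn_add f g, hf, hg] with x h1 h2 h3
    rw [h1, Pi.add_apply, h2, h3, hφ.iteratedDeriv_add hψ]
  smul_mem' := by
    rintro c f ⟨φ, hφ, hf⟩
    refine ⟨c • φ, hφ.smul c, ?_⟩
    filter_upwards [Lp.coeFn_smul c f, hf] with x h1 h2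
    rw [h1, Pi.smul_apply, h2, iteratedDeriv_const_smul_field]

/-- A function orthogonal to all `φ''` has zero second weak derivative, hence is affine. The four
boundary values make `u₂` orthogonal to affine functions, so `u₂` lies in the double orthogonal
complement, which is the closure. -/
lemma toLp_mem_closure_testSecondDerivs (hL : 0 < L) {u u₁ u₂ : ℝ → ℝ}
    (h0 : ∀ x, HasDerivAt u (u₁ x) x) (h1 : ∀ x, HasDerivAt u₁ (u₂ x) x) (h2 : Continuous u₂) (hu0 : u 0 = 0) (huL : u L = 0)
    (hu10 : u₁ 0 = 0) (hu1L : u₁ L = 0) :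
    (memLp_volI_of_continuous h2 2).toLp u₂ ∈ (testSecondDerivs L).topologicalClosure := by
  rw [← Submodule.orthogonal_orthogonal_eq_closure, Submodule.mem_orthogonal]
  intro g hg
  have hgm : MemLp g 2 (volI L) := Lp.memLp g
  have hw : HasWeakDeriv L 2 g 0 := by
    refine ⟨MemLp.locallyIntegrableOn_Ioo hgm, locallyIntegrableOn_zero, fun φ hφ => ?_⟩
    have hm := (hφ.iteratedDeriv 2).memLp (2 : ℝ≥0∞)
    have h3 := (Submodule.mem_orthogonal' _ _).1 hg (hm.toLp _) ⟨φ, hφ, hm.coeFn_toLp⟩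
    have h4 := inner_toLp_eq hgm hm
    rw [Lp.toLp_coeFn, h3] at h4
    simp [← h4]
  obtain ⟨c, d, hcd⟩ := hw.ae_eq_affine hL
  have h4 := inner_toLp_eq hgm (memLp_volI_of_continuous (L := L) h2 2)
  rw [Lp.toLp_coeFn] at h4
  rw [h4]
  have h5 : ∫ x in Ioo 0 L, g x * u₂ x = ∫ x in Ioo 0 L, (c + d * x) * u₂ x :=
    integral_congr_ae (by filter_upwards [hcd] with x hx; rw [hx])
  have hd : ∀ x, HasDerivAt (fun x => (c + d * x) * u₁ x - d * u x) ((c + d * x) * u₂ x) x := by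
    intro x
    have := ((((hasDerivAt_id x).const_mul d).const_add c).mul (h1 x)).sub ((h0 x).const_mul d)
    refine this.congr_deriv ?_
    simp
  rw [h5, setIntegral_Ioo_eq hL.le, intervalIntegral.integral_eq_sub_of_hasDerivAt
    (fun x _ => hd x)
    ((by fun_prop : Continuous fun x => (c + d * x) * u₂ x).intervalIntegrable _ _)]
  simp [hu0, huL, hu10, hu1L]

/-- Test functions with `φ''` close to `u₂` exist by density. Two applications of the Poincaré
inequality from `0` carry the convergence to the first derivative and to the function. -/
lemma memH20_of_boundary_values (hL : 0 < L) {u u₁ u₂ : ℝ → ℝ}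
    (h0 : ∀ x, HasDerivAt u (u₁ x) x) (h1 : ∀ x, HasDerivAt u₁ (u₂ x) x) (h2 : Continuous u₂) (hu0 : u 0 = 0) (huL : u L = 0)
    (hu10 : u₁ 0 = 0) (hu1L : u₁ L = 0) : MemH20 L u := by
  have c0 : Continuous u := continuous_iff_continuousAt.2 fun x => (h0 x).continuousAt
  have c1 : Continuous u₁ := continuous_iff_continuousAt.2 fun x => (h1 x).continuousAt
  have w0 : HasWeakDeriv L 0 u u := HasWeakDeriv.self (c0.locallyIntegrableOn _)
  have w1 : HasWeakDeriv L 1 u u₁ := HasWeakDeriv.of_hasDerivAt hL c1 h0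
  have w2 : HasWeakDeriv L 2 u u₂ := w1.comp (HasWeakDeriv.of_hasDerivAt hL h2 h1)
  refine ⟨fun j hj => ?_, ?_⟩
  · interval_cases j
    · exact ⟨u, w0, memLp_volI_of_continuous c0 2⟩
    · exact ⟨u₁, w1, memLp_volI_of_continuous c1 2⟩
    · exact ⟨u₂, w2, memLp_volI_of_continuous h2 2⟩
  have hcl := toLp_mem_closure_testSecondDerivs hL h0 h1 h2 hu0 huL hu10 hu1L
  obtain ⟨f, hf, hlim⟩ := mem_closure_iff_seq_limit.1 hcl
  choose φ hφ hfφ using hf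
  refine ⟨φ, hφ, ?_⟩
  have d0 : ∀ m x, HasDerivAt (fun x => u x - φ m x) (u₁ x - deriv (φ m) x) x := fun m x =>
    (h0 x).sub ((hφ m).hasDerivAt x)
  have d1 : ∀ m x, HasDerivAt (fun x => u₁ x - deriv (φ m) x) (u₂ x - deriv (deriv (φ m)) x) x :=
    fun m x => (h1 x).sub ((hφ m).deriv.hasDerivAt x)
  have l2 : Tendsto (fun m => eLpNorm (fun x => u₂ x - deriv (deriv (φ m)) x) 2 (volI L)) atTop
      (𝓝 0) := by
    rw [Lp.tendsto_Lp_iff_tendsto_eLpNorm'] at hlim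
    refine hlim.congr fun m => ?_
    rw [← eLpNorm_neg]
    refine eLpNorm_congr_ae ?_
    filter_upwards [hfφ m, (memLp_volI_of_continuous (L := L) h2 2).coeFn_toLp] with x e1 e2
    rw [Pi.neg_apply, Pi.sub_apply, e1, e2, neg_sub, iteratedDeriv_succ, iteratedDeriv_one]
  have lift : ∀ {F F' : ℕ → ℝ → ℝ}, (∀ m x, HasDerivAt (F m) (F' m x) x) →
      (∀ m, Continuous (F' m)) → (∀ m, F m 0 = 0) →
      Tendsto (fun m => eLpNorm (F' m) 2 (volI L)) atTop (𝓝 0) →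
      Tendsto (fun m => eLpNorm (F m) 2 (volI L)) atTop (𝓝 0) := by
    intro F F' hF hF' hF0 hl
    have l3 := ENNReal.Tendsto.const_mul (a := ENNReal.ofReal L) hl (Or.inr ENNReal.ofReal_ne_top)
    rw [mul_zero] at l3
    exact tendsto_of_tendsto_of_tendsto_of_le_of_le tendsto_const_nhds l3 (fun _ => zero_le)
      fun m => eLpNorm_le_eLpNorm_deriv hL (hF m) (hF' m) (hF0 m)
  have hn : (0 : ℝ) ∉ Ioo 0 L := fun h => lt_irrefl _ h.1
  have l1 := lift d1 (fun m => h2.sub (hφ m).deriv.deriv.continuous)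
    (fun m => by rw [hu10, (hφ m).deriv.eq_zero_of_notMem hn, sub_zero]) l2
  have l0 := lift d0 (fun m => c1.sub (hφ m).deriv.continuous)
    (fun m => by rw [hu0, (hφ m).eq_zero_of_notMem hn, sub_zero]) l1
  have fin : ∀ {j : ℕ} {g w : ℝ → ℝ}, HasWeakDeriv L j u g → HasWeakDeriv L j u w →
      Tendsto (fun m => eLpNorm (fun x => w x - iteratedDeriv j (φ m) x) 2 (volI L)) atTop
        (𝓝 0) →
      Tendsto (fun m => eLpNorm (fun x => g x - iteratedDeriv j (φ m) x) 2 (volI L)) atTop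
        (𝓝 0) := by
    intro j g w hg hw hl
    refine hl.congr fun m => eLpNorm_congr_ae ?_
    filter_upwards [hw.unique hg] with x hx
    rw [hx]
  intro j hj g hg
  interval_cases j
  · exact fin hg w0 (by simpa only [iteratedDeriv_zero] using l0)
  · exact fin hg w1 (by simpa only [iteratedDeriv_one] using l1)
  · exact fin hg w2 (by simpa only [iteratedDeriv_succ, iteratedDeriv_zero] using l2)

/-! ### Primitives of elements of `L²_{x dx}` -/

lemma restrict_Ioo_le_smul_xMeasure {a : ℝ} (ha : 0 < a) :
    volume.restrict (Ioo a L) ≤ ENNReal.ofReal a⁻¹ • xMeasure L := by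
  refine Measure.le_iff.2 fun s hs => ?_
  rw [Measure.smul_apply, smul_eq_mul, xMeasure, withDensity_apply _ hs, Measure.restrict_apply hs,
    Measure.restrict_restrict hs]
  have h1 : ENNReal.ofReal a * volume (s ∩ Ioo a L)
      ≤ ∫⁻ x in s ∩ Ioo 0 L, ENNReal.ofReal x := by
    rw [← setLIntegral_const]
    refine (setLIntegral_mono (by fun_prop) fun x hx => ?_).trans
      (lintegral_mono_set (inter_subset_inter_right s (Ioo_subset_Ioo_left ha.le)))
    exact ENNReal.ofReal_le_ofReal hx.2.1.le
  calc volume (s ∩ Ioo a L)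
      = ENNReal.ofReal a⁻¹ * (ENNReal.ofReal a * volume (s ∩ Ioo a L)) := by
        rw [← mul_assoc, ← ENNReal.ofReal_mul (inv_nonneg.2 ha.le), inv_mul_cancel₀ ha.ne',
          ENNReal.ofReal_one, one_mul]
    _ ≤ _ := by gcongr

lemma integrableOn_Ioo_of_memLp_xMeasure {f : ℝ → ℝ} (hf : MemLp f 2 (xMeasure L)) {a : ℝ}
    (ha : 0 < a) : IntegrableOn f (Ioo a L) :=
  (hf.of_measure_le_smul ENNReal.ofReal_ne_top (restrict_Ioo_le_smul_xMeasure ha)).integrable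
    (by norm_num)

lemma intervalIntegrable_of_memLp_xMeasure {f : ℝ → ℝ} (hf : MemLp f 2 (xMeasure L)) {x : ℝ}
    (hx : x ∈ Ioo 0 L) : IntervalIntegrable f volume L x := by
  rw [intervalIntegrable_iff, uIoc_of_ge hx.2.le, integrableOn_Ioc_iff_integrableOn_Ioo]
  exact integrableOn_Ioo_of_memLp_xMeasure hf hx.1

lemma locallyIntegrableOn_of_memLp_xMeasure {f : ℝ → ℝ} (hf : MemLp f 2 (xMeasure L)) :
    LocallyIntegrableOn f (Ioo 0 L) := by
  intro x hx
  exact ⟨Ioo (x / 2) L, mem_nhdsWithin_of_mem_nhds (Ioo_mem_nhds (by linarith [hx.1]) hx.2),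
    integrableOn_Ioo_of_memLp_xMeasure hf (half_pos hx.1)⟩

lemma hasWeakDeriv_primitive (hL : 0 < L) {f : ℝ → ℝ} (hf : MemLp f 2 (xMeasure L)) :
    HasWeakDeriv L 1 (fun x => ∫ t in L..x, f t) f :=
  HasWeakDeriv.of_integral hL (locallyIntegrableOn_of_memLp_xMeasure hf) fun _ hx _ hy =>
    intervalIntegral.integral_interval_sub_left (intervalIntegrable_of_memLp_xMeasure hf hy)
      (intervalIntegrable_of_memLp_xMeasure hf hx)

/-- Cauchy–Schwarz in `L²_{x dx}` against `1/t` on `(x, L)`, whose squared weighted norm is `∫ dt/t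
= log L - log x`. -/
lemma sq_primitive_le {f : ℝ → ℝ} (hf : MemLp f 2 (xMeasure L)) {x : ℝ} (hx : x ∈ Ioo 0 L) :
    (∫ t in L..x, f t) ^ 2
      ≤ (∫ t, f t * f t ∂xMeasure L) * (Real.log L - Real.log x) := by
  let g : ℝ → ℝ := (Ioo x L).indicator fun t => t⁻¹
  have hg : MemLp g 2 (volI L) := by
    refine MemLp.of_bound ((measurable_inv.indicator measurableSet_Ioo).aestronglyMeasurable) x⁻¹
      (Eventually.of_forall fun t => ?_)
    by_cases ht : t ∈ Ioo x L
    · simp only [g, indicator_of_mem ht]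
      rw [norm_inv, Real.norm_of_nonneg (hx.1.trans ht.1).le]
      exact inv_anti₀ hx.1 ht.1.le
    · simp only [g, indicator_of_notMem ht, norm_zero]
      exact inv_nonneg.2 hx.1.le
  have h1 := sq_integral_mul_le hf (MemLp.xMeasure_of_volI hg)
  have hsub : Ioo 0 L ∩ Ioo x L = Ioo x L :=
    inter_eq_right.2 (Ioo_subset_Ioo_left hx.1.le)
  have e1 : ∫ t, f t * g t ∂xMeasure L = -∫ t in L..x, f t := by
    have : ∀ t, t * (f t * g t) = (Ioo x L).indicator f t := by
      intro t
      by_cases ht : t ∈ Ioo x L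
      · simp only [g, indicator_of_mem ht]
        have := (hx.1.trans ht.1).ne'
        field_simp
      · simp only [g, indicator_of_notMem ht, mul_zero]
    rw [integral_xMeasure]
    simp only [this]
    rw [setIntegral_indicator measurableSet_Ioo, hsub, ← intervalIntegral.integral_symm,
      intervalIntegral.integral_of_le hx.2.le, integral_Ioc_eq_integral_Ioo]
  have e2 : ∫ t, g t * g t ∂xMeasure L = Real.log L - Real.log x := by
    have : ∀ t, t * (g t * g t) = (Ioo x L).indicator (fun t => t⁻¹) t := by
      intro t
      by_cases ht : t ∈ Ioo x L
      · simp only [g, indicator_of_mem ht]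
        have := (hx.1.trans ht.1).ne'
        field_simp
      · simp only [g, indicator_of_notMem ht, mul_zero]
    rw [integral_xMeasure]
    simp only [this]
    rw [setIntegral_indicator measurableSet_Ioo, hsub, ← integral_Ioc_eq_integral_Ioo,
      ← intervalIntegral.integral_of_le hx.2.le, integral_inv_of_pos hx.1 (hx.1.trans hx.2),
      Real.log_div (hx.1.trans hx.2).ne' hx.1.ne']
  rwa [e1, e2, neg_sq] at h1

/-- The logarithm is integrable at `0`. Thus a fifth derivative in the weighted space still leaves
the fourth in the unweighted `L²`, as membership in `H⁴` demands. -/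
lemma memLp_primitive (hL : 0 < L) {f : ℝ → ℝ} (hf : MemLp f 2 (xMeasure L)) :
    MemLp (fun x => ∫ t in L..x, f t) 2 (volI L) := by
  have hm : AEStronglyMeasurable (fun x => ∫ t in L..x, f t) (volI L) :=
    (hasWeakDeriv_primitive hL hf).locInt.aestronglyMeasurable
  rw [memLp_two_iff_integrable_sq hm]
  have hlog : Integrable (fun x => Real.log x) (volI L) := by
    have := intervalIntegral.intervalIntegrable_log' (a := 0) (b := L)
    rwa [intervalIntegrable_iff_integrableOn_Ioo_of_le hL.le] at this
  refine (((integrable_const (Real.log L)).sub hlog).const_mul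
    (∫ t, f t * f t ∂xMeasure L)).mono' (hm.pow 2) ?_
  filter_upwards [ae_restrict_mem measurableSet_Ioo] with x hx
  rw [Real.norm_of_nonneg (sq_nonneg _)]
  exact sq_primitive_le hf hx

/-! ### Linear differential equations -/

open NormedSpace (exp) in
-- Variation of constants.
lemma exists_linear_ode_solution {E : Type*} [NormedAddCommGroup E] [NormedSpace ℝ E]
    [CompleteSpace E] (M : E →L[ℝ] E) {r : ℝ → E} (hr : Continuous r) (x₀ : ℝ) (U₀ : E) :
    ∃ U : ℝ → E, U x₀ = U₀ ∧ ∀ x, HasDerivAt U (M (U x) + r x) x := by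
  have hd : ∀ x, HasDerivAt (fun x : ℝ => exp ((x - x₀) • M)) (M * exp ((x - x₀) • M)) x := by
    intro x
    simpa using (hasDerivAt_exp_smul_const' (𝕂 := ℝ) M (x - x₀)).comp_sub_const x x₀
  have hc : Continuous fun x : ℝ => exp ((x₀ - x) • M) := by
    let +nondep : NormedAlgebra ℚ (E →L[ℝ] E) := .restrictScalars ℚ ℝ _
    exact NormedSpace.exp_continuous.comp (by fun_prop)
  have hinv : ∀ x : ℝ, exp ((x - x₀) • M) * exp ((x₀ - x) • M) = 1 := by
    intro x
    rw [← exp_add_of_commute_clm (((Commute.refl M).smul_left _).smul_right _), ← add_smul]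
    simp [NormedSpace.exp_zero]
  have hcr : Continuous fun x : ℝ => exp ((x₀ - x) • M) (r x) := hc.clm_apply hr
  refine ⟨fun x => exp ((x - x₀) • M) (U₀ + ∫ y in x₀..x, exp ((x₀ - y) • M) (r y)), ?_,
    fun x => ?_⟩
  · simp [NormedSpace.exp_zero]
  · have hV : HasDerivAt (fun x => U₀ + ∫ y in x₀..x, exp ((x₀ - y) • M) (r y))
        (exp ((x₀ - x) • M) (r x)) x :=
      (intervalIntegral.integral_hasDerivAt_right (hcr.intervalIntegrable _ _)
        hcr.aestronglyMeasurable.stronglyMeasurableAtFilter hcr.continuousAt).const_add U₀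
    refine ((hd x).clm_apply hV).congr_deriv ?_
    rw [← mul_apply_eq_comp (exp ((x - x₀) • M)) (exp ((x₀ - x) • M)), hinv, mul_apply_eq_comp]
    rfl

/-- Classical solutions of `w⁽⁵⁾ = c w - w''' + r` on `ℝ`, as tuples of derivatives. -/
structure IsSolution (c : ℝ) (r : ℝ → ℝ) (w : Fin 5 → ℝ → ℝ) : Prop where
  d0 : ∀ x, HasDerivAt (w 0) (w 1 x) x
  d1 : ∀ x, HasDerivAt (w 1) (w 2 x) x
  d2 : ∀ x, HasDerivAt (w 2) (w 3 x) x
  d3 : ∀ x, HasDerivAt (w 3) (w 4 x) x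
  d4 : ∀ x, HasDerivAt (w 4) (c * w 0 x - w 3 x + r x) x

lemma IsSolution.exists (c : ℝ) {r : ℝ → ℝ} (hr : Continuous r) (x₀ : ℝ) (U₀ : Fin 5 → ℝ) :
    ∃ w, IsSolution c r w ∧ ∀ i, w i x₀ = U₀ i := by
  let p : Fin 5 → (Fin 5 → ℝ) →L[ℝ] ℝ := fun i => ContinuousLinearMap.proj i
  let M : (Fin 5 → ℝ) →L[ℝ] (Fin 5 → ℝ) :=
    ContinuousLinearMap.pi ![p 1, p 2, p 3, p 4, c • p 0 - p 3]
  have hr' : Continuous fun x => (![0, 0, 0, 0, r x] : Fin 5 → ℝ) := by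
    refine continuous_pi fun i => ?_
    fin_cases i
    · exact continuous_const
    · exact continuous_const
    · exact continuous_const
    · exact continuous_const
    · exact hr
  obtain ⟨U, hU0, hU⟩ := exists_linear_ode_solution M hr' x₀ U₀
  have hUi : ∀ i x, HasDerivAt (fun x => U x i) ((M (U x) + ![0, 0, 0, 0, r x]) i) x :=
    fun i x => hasDerivAt_pi.1 (hU x) i
  refine ⟨fun i x => U x i, ⟨fun x => ?_, fun x => ?_, fun x => ?_, fun x => ?_, fun x => ?_⟩,
    fun i => congrFun hU0 i⟩
  · simpa [M, p] using hUi 0 x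
  · simpa [M, p] using hUi 1 x
  · simpa [M, p] using hUi 2 x
  · simpa [M, p] using hUi 3 x
  · simpa [M, p] using hUi 4 x

namespace IsSolution

variable {c : ℝ} {r s : ℝ → ℝ} {w v : Fin 5 → ℝ → ℝ}

lemma continuous (h : IsSolution c r w) (i : Fin 5) : Continuous (w i) := by
  refine continuous_iff_continuousAt.2 fun x => ?_
  fin_cases i
  · exact (h.d0 x).continuousAt
  · exact (h.d1 x).continuousAt
  · exact (h.d2 x).continuousAt
  · exact (h.d3 x).continuousAt
  · exact (h.d4 x).continuousAt

lemma add (h : IsSolution c r w) (k : IsSolution c s v) :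
    IsSolution c (fun x => r x + s x) (fun i x => w i x + v i x) :=
  ⟨fun x => (h.d0 x).add (k.d0 x), fun x => (h.d1 x).add (k.d1 x), fun x => (h.d2 x).add (k.d2 x),
    fun x => (h.d3 x).add (k.d3 x), fun x => ((h.d4 x).add (k.d4 x)).congr_deriv (by ring)⟩

lemma const_mul (h : IsSolution c r w) (a : ℝ) :
    IsSolution c (fun x => a * r x) (fun i x => a * w i x) :=
  ⟨fun x => (h.d0 x).const_mul a, fun x => (h.d1 x).const_mul a, fun x => (h.d2 x).const_mul a,
    fun x => (h.d3 x).const_mul a, fun x => ((h.d4 x).const_mul a).congr_deriv (by ring)⟩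

end IsSolution

/-! ### Membership in the domain -/

/-- Regularity is required only as far as a right-hand side in `L²_{x dx}` allows: classical
derivatives up to order three, then weak ones. -/
lemma memDomain_of_boundary_values (hL : 0 < L) {u₀ u₁ u₂ u₃ u₄ g : ℝ → ℝ}
    (h0 : ∀ x, HasDerivAt u₀ (u₁ x) x) (h1 : ∀ x, HasDerivAt u₁ (u₂ x) x)
    (h2 : ∀ x, HasDerivAt u₂ (u₃ x) x) (c3 : Continuous u₃) (h3 : HasWeakDeriv L 1 u₃ u₄)
    (hu4 : MemLp u₄ 2 (volI L)) (h4 : HasWeakDeriv L 1 u₄ g) (hg : MemLp g 2 (xMeasure L))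
    (hu00 : u₀ 0 = 0) (hu0L : u₀ L = 0) (hu10 : u₁ 0 = 0) (hu1L : u₁ L = 0) (hu2L : u₂ L = 0) :
    MemDomain L u₀ ∧ HasWeakDeriv L 3 u₀ u₃ ∧ HasWeakDeriv L 5 u₀ g := by
  have c0 : Continuous u₀ := continuous_iff_continuousAt.2 fun x => (h0 x).continuousAt
  have c1 : Continuous u₁ := continuous_iff_continuousAt.2 fun x => (h1 x).continuousAt
  have c2 : Continuous u₂ := continuous_iff_continuousAt.2 fun x => (h2 x).continuousAt
  have w0 : HasWeakDeriv L 0 u₀ u₀ := HasWeakDeriv.self (c0.locallyIntegrableOn _)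
  have w1 : HasWeakDeriv L 1 u₀ u₁ := HasWeakDeriv.of_hasDerivAt hL c1 h0
  have w2 : HasWeakDeriv L 2 u₀ u₂ := w1.comp (HasWeakDeriv.of_hasDerivAt hL c2 h1)
  have w3 : HasWeakDeriv L 3 u₀ u₃ := w2.comp (HasWeakDeriv.of_hasDerivAt hL c3 h2)
  have w4 : HasWeakDeriv L 4 u₀ u₄ := w3.comp h3
  have w5 : HasWeakDeriv L 5 u₀ g := w4.comp h4
  refine ⟨⟨fun j hj => ?_, memH20_of_boundary_values hL h0 h1 c2 hu00 hu0L hu10 hu1L,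
    ⟨g, w5, hg⟩, ⟨u₂, w2, c2.continuousOn, hu2L⟩⟩, w3, w5⟩
  interval_cases j
  · exact ⟨u₀, w0, memLp_volI_of_continuous c0 2⟩
  · exact ⟨u₁, w1, memLp_volI_of_continuous c1 2⟩
  · exact ⟨u₂, w2, memLp_volI_of_continuous c2 2⟩
  · exact ⟨u₃, w3, memLp_volI_of_continuous c3 2⟩
  · exact ⟨u₄, w4, hu4⟩

/-! ### Surjectivity of `c + A₁` -/

lemma eq_zero_on_Ioo_of_hasDerivAt {F F' : ℝ → ℝ} (hF : ∀ x, HasDerivAt F (F' x) x)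
    (h : ∀ x ∈ Ioo 0 L, F x = 0) : ∀ x ∈ Ioo 0 L, F' x = 0 := by
  intro x hx
  refine (hF x).unique ((hasDerivAt_const x (0 : ℝ)).congr_of_eventuallyEq ?_)
  filter_upwards [isOpen_Ioo.mem_nhds hx] with y hy
  exact h y hy

/-- Such a `w 0` lies in the domain and is mapped to `c w 0` by `-A₁`. As `c` exceeds the
quasi-dissipativity constant, the energy inequality forces it to vanish on `(0, L)`. The conclusion
is stated for the Cauchy data at `L` left free in the shooting argument. -/
lemma IsSolution.eq_zero_of_boundary_values (hL : 0 < L) {c : ℝ} (hc : L * (2 + L ^ 2) ^ 3 < c)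
    {w : Fin 5 → ℝ → ℝ} (h : IsSolution c (fun _ => 0) w) (h00 : w 0 0 = 0) (h0L : w 0 L = 0)
    (h10 : w 1 0 = 0) (h1L : w 1 L = 0) (h2L : w 2 L = 0) : w 3 L = 0 ∧ w 4 L = 0 := by
  have cg : Continuous fun x => c * w 0 x - w 3 x + 0 := by
    have := h.continuous 0
    have := h.continuous 3
    fun_prop
  obtain ⟨hD, w3, w5⟩ := memDomain_of_boundary_values hL h.d0 h.d1 h.d2 (h.continuous 3)
    (HasWeakDeriv.of_hasDerivAt hL (h.continuous 4) h.d3)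
    (memLp_volI_of_continuous (h.continuous 4) 2)
    (HasWeakDeriv.of_hasDerivAt hL cg h.d4)
    (MemLp.xMeasure_of_volI (memLp_volI_of_continuous cg 2)) h00 h0L h10 h1L h2L
  have h1 := hD.integral_le hL w5 w3 (MemLp.xMeasure_of_volI (memLp_volI_of_continuous cg 2))
    (memLp_volI_of_continuous (h.continuous 3) 2)
  have e1 : ∫ x, (c * w 0 x - w 3 x + 0 + w 3 x) * w 0 x ∂xMeasure L
      = c * ∫ x, w 0 x * w 0 x ∂xMeasure L := by
    rw [← integral_const_mul]
    congr 1; ext x; ring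
  rw [e1] at h1
  have hm := MemLp.xMeasure_of_volI (memLp_volI_of_continuous (L := L) (h.continuous 0) 2)
  have h2 : 0 ≤ ∫ x, w 0 x * w 0 x ∂xMeasure L := integral_nonneg fun x => mul_self_nonneg _
  have h3 : ∫ x, w 0 x * w 0 x ∂xMeasure L = 0 := by nlinarith
  have h4 := ae_volI_of_ae_xMeasure ((integral_eq_zero_iff_of_nonneg
    (fun x => mul_self_nonneg (w 0 x)) (integrable_mul_of_memLp hm hm)).1 h3)
  have z0 : ∀ x ∈ Ioo 0 L, w 0 x = 0 := by
    refine Measure.eqOn_open_of_ae_eq (f := w 0) (g := fun _ => 0) (μ := volume) ?_ isOpen_Ioo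
      (h.continuous 0).continuousOn continuousOn_const
    filter_upwards [h4] with x hx
    exact mul_self_eq_zero.1 hx
  have z1 := eq_zero_on_Ioo_of_hasDerivAt h.d0 z0
  have z2 := eq_zero_on_Ioo_of_hasDerivAt h.d1 z1
  have z3 := eq_zero_on_Ioo_of_hasDerivAt h.d2 z2
  have z4 := eq_zero_on_Ioo_of_hasDerivAt h.d3 z3
  have fin : ∀ i, (∀ x ∈ Ioo 0 L, w i x = 0) → w i L = 0 := by
    intro i hi
    have := EqOn.closure (f := w i) (g := fun _ => 0) hi (h.continuous i) continuous_const
    rw [closure_Ioo hL.ne] at this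
    exact this (right_mem_Icc.2 hL.le)
  exact ⟨fin 3 z3, fin 4 z4⟩

lemma exists_solution_two_by_two {a b c d : ℝ}
    (h : ∀ s t : ℝ, s * a + t * b = 0 → s * c + t * d = 0 → s = 0 ∧ t = 0) (p q : ℝ) :
    ∃ s t : ℝ, s * a + t * b = p ∧ s * c + t * d = q := by
  -- With zero determinant, `(d, -c)` and `(b, -a)` lie in the kernel. Hence all entries vanish, and
  -- then so does `(1, 0)` under the map, a contradiction.
  have hdet : a * d - b * c ≠ 0 := by
    intro h0
    have h1 := h d (-c) (by linarith) (by ring)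
    have h2 := h b (-a) (by ring) (by linarith)
    have ha : a = 0 := by linarith [h2.2]
    have h3 := h 1 0 (by rw [ha]; ring) (by linarith [h1.2])
    exact one_ne_zero h3.1
  refine ⟨(d * p - b * q) / (a * d - b * c), (a * q - c * p) / (a * d - b * c), ?_, ?_⟩
  · rw [div_mul_eq_mul_div, div_mul_eq_mul_div, ← add_div, div_eq_iff hdet]
    ring
  · rw [div_mul_eq_mul_div, div_mul_eq_mul_div, ← add_div, div_eq_iff hdet]
    ring

/-- Solvability of the boundary value problem for `w⁽⁵⁾ = c w - w''' + r`. -/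
lemma IsSolution.exists_boundary_values (hL : 0 < L) {c : ℝ} (hc : L * (2 + L ^ 2) ^ 3 < c)
    {r : ℝ → ℝ} (hr : Continuous r) (p q : ℝ) :
    ∃ w, IsSolution c r w ∧ w 0 0 = p ∧ w 1 0 = q ∧ w 0 L = 0 ∧ w 1 L = 0 ∧ w 2 L = 0 := by
  -- Shooting from `L`: the three conditions there are built into the Cauchy data. The free values
  -- of the third and fourth derivatives at `L`, carried by `P` and `Q`, are tuned to meet the two
  -- conditions at `0`. Uniqueness makes that `2 × 2` system invertible.
  obtain ⟨R, hR, hRL⟩ := IsSolution.exists c hr L 0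
  obtain ⟨P, hP, hPL⟩ := IsSolution.exists c (r := fun _ => 0) continuous_const L ![0, 0, 0, 1, 0]
  obtain ⟨Q, hQ, hQL⟩ := IsSolution.exists c (r := fun _ => 0) continuous_const L ![0, 0, 0, 0, 1]
  have P0 : P 0 L = 0 := by simpa using hPL 0
  have P1 : P 1 L = 0 := by simpa using hPL 1
  have P2 : P 2 L = 0 := by simpa using hPL 2
  have P3 : P 3 L = 1 := by simpa using hPL 3
  have P4 : P 4 L = 0 := by simpa using hPL 4
  have Q0 : Q 0 L = 0 := by simpa using hQL 0
  have Q1 : Q 1 L = 0 := by simpa using hQL 1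
  have Q2 : Q 2 L = 0 := by simpa using hQL 2
  have Q3 : Q 3 L = 0 := by simpa using hQL 3
  have Q4 : Q 4 L = 1 := by simpa using hQL 4
  obtain ⟨s, t, h1, h2⟩ := exists_solution_two_by_two (a := P 0 0) (b := Q 0 0) (c := P 1 0)
    (d := Q 1 0) (fun s t h1 h2 => by
      have hw := (hP.const_mul s).add (hQ.const_mul t)
      simp only [mul_zero, add_zero] at hw
      have := hw.eq_zero_of_boundary_values hL hc h1 (by simp [P0, Q0]) h2 (by simp [P1, Q1])
        (by simp [P2, Q2])
      simpa [P3, P4, Q3, Q4] using this) (p - R 0 0) (q - R 1 0)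
  have hw := hR.add ((hP.const_mul s).add (hQ.const_mul t))
  simp only [mul_zero, add_zero] at hw
  refine ⟨_, hw, ?_, ?_, ?_, ?_, ?_⟩
  · simp only [h1]; ring
  · simp only [h2]; ring
  · simp [hRL, P0, Q0]
  · simp [hRL, P1, Q1]
  · simp [hRL, P2, Q2]

lemma hasDerivAt_primitive {f : ℝ → ℝ} (hf : Continuous f) (a x : ℝ) :
    HasDerivAt (fun x => ∫ t in a..x, f t) (f x) x :=
  intervalIntegral.integral_hasDerivAt_right (hf.intervalIntegrable _ _)
    hf.aestronglyMeasurable.stronglyMeasurableAtFilter hf.continuousAt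

/-- The solution is sought as `w + h₀`, where `h₀` has fifth weak derivative `-f` and carries all
the roughness, while `w` solves an ODE with continuous data. -/
theorem exists_smul_sub_neg_A₁_eq (hL : 0 < L) {c : ℝ} (hc : L * (2 + L ^ 2) ^ 3 < c)
    (f : L2x L) : ∃ u : (-A₁ L).domain, c • (u : L2x L) - (-A₁ L) u = f := by
  have hf : MemLp f 2 (xMeasure L) := Lp.memLp f
  -- The cutoff makes `h₄` integrable on all of `ℝ`, so the further primitives are defined and
  -- differentiable everywhere; on `(0, L)` nothing changes.
  let h₄ : ℝ → ℝ := (Ioo 0 L).indicator fun x => (-1 : ℝ) • ∫ t in L..x, f t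
  have hae : (-1 : ℝ) • (fun x => ∫ t in L..x, f t) =ᵐ[volI L] h₄ := by
    filter_upwards [ae_restrict_mem measurableSet_Ioo] with x hx
    simp only [h₄, indicator_of_mem hx, Pi.smul_apply]
  have m4 : MemLp h₄ 2 (volI L) :=
    (memLp_congr_ae hae).1 ((memLp_primitive hL hf).const_smul (-1 : ℝ))
  have d4 : HasWeakDeriv L 1 h₄ ((-1 : ℝ) • f) :=
    ((hasWeakDeriv_primitive hL hf).smul (-1)).congr hae .rfl
  have i4 : Integrable h₄ := by
    have h : IntegrableOn h₄ (Ioo 0 L) := m4.integrable (by norm_num)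
    rw [← integrableOn_iff_integrable_of_support_subset (s := Ioo 0 L)]
    · exact h
    · exact support_indicator_subset
  let h₃ : ℝ → ℝ := fun x => ∫ t in L..x, h₄ t
  let h₂ : ℝ → ℝ := fun x => ∫ t in L..x, h₃ t
  let h₁ : ℝ → ℝ := fun x => ∫ t in L..x, h₂ t
  let h₀ : ℝ → ℝ := fun x => ∫ t in L..x, h₁ t
  have c3 : Continuous h₃ :=
    intervalIntegral.continuous_primitive (fun _ _ => i4.intervalIntegrable) L
  have d3 : HasWeakDeriv L 1 h₃ h₄ :=
    HasWeakDeriv.of_integral hL d4.locInt fun _ _ _ _ =>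
      intervalIntegral.integral_interval_sub_left i4.intervalIntegrable i4.intervalIntegrable
  have d2 : ∀ x, HasDerivAt h₂ (h₃ x) x := hasDerivAt_primitive c3 L
  have c2 : Continuous h₂ := continuous_iff_continuousAt.2 fun x => (d2 x).continuousAt
  have d1 : ∀ x, HasDerivAt h₁ (h₂ x) x := hasDerivAt_primitive c2 L
  have c1 : Continuous h₁ := continuous_iff_continuousAt.2 fun x => (d1 x).continuousAt
  have d0 : ∀ x, HasDerivAt h₀ (h₁ x) x := hasDerivAt_primitive c1 L
  have c0 : Continuous h₀ := continuous_iff_continuousAt.2 fun x => (d0 x).continuousAt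
  have z0 : h₀ L = 0 := intervalIntegral.integral_same
  have z1 : h₁ L = 0 := intervalIntegral.integral_same
  have z2 : h₂ L = 0 := intervalIntegral.integral_same
  -- The source `c h₀ - h₃` is what `h₀` leaves over in the equation, and the values at `0` cancel
  -- those of `h₀` and `h₁`. At `L` the primitives already vanish.
  obtain ⟨w, hw, w00, w10, w0L, w1L, w2L⟩ := IsSolution.exists_boundary_values hL hc
    (r := fun x => c * h₀ x - h₃ x) (by fun_prop) (-h₀ 0) (-h₁ 0)
  have cg : Continuous fun x => c * w 0 x - w 3 x + (c * h₀ x - h₃ x) := by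
    have := hw.continuous 0
    have := hw.continuous 3
    fun_prop
  have mg := MemLp.xMeasure_of_volI (memLp_volI_of_continuous (L := L) cg 2)
  have m4' : MemLp (w 4 + h₄) 2 (volI L) :=
    (memLp_volI_of_continuous (hw.continuous 4) 2).add m4
  obtain ⟨hD, t3, t5⟩ := memDomain_of_boundary_values hL
    (u₀ := w 0 + h₀) (u₁ := w 1 + h₁) (u₂ := w 2 + h₂) (u₃ := w 3 + h₃) (u₄ := w 4 + h₄)
    (fun x => (hw.d0 x).add (d0 x)) (fun x => (hw.d1 x).add (d1 x))
    (fun x => (hw.d2 x).add (d2 x)) ((hw.continuous 3).add c3)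
    ((HasWeakDeriv.of_hasDerivAt hL (hw.continuous 4) hw.d3).add d3) m4'
    ((HasWeakDeriv.of_hasDerivAt hL cg hw.d4).add d4) (mg.add (hf.const_smul (-1 : ℝ)))
    (by simp [w00]) (by simp [w0L, z0]) (by simp [w10]) (by simp [w1L, z1]) (by simp [w2L, z2])
  have mu : MemLp (w 0 + h₀) 2 (xMeasure L) :=
    MemLp.xMeasure_of_volI (memLp_volI_of_continuous ((hw.continuous 0).add c0) 2)
  have hcoe := mu.coeFn_toLp
  have hcoe' : w 0 + h₀ =ᵐ[volI L] mu.toLp (w 0 + h₀) := ae_volI_of_ae_xMeasure hcoe.symm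
  have hDu : MemDomain L (mu.toLp (w 0 + h₀)) := hD.congr hcoe'
  refine ⟨⟨mu.toLp (w 0 + h₀), hDu⟩, ?_⟩
  have e : ((-A₁ L) ⟨mu.toLp (w 0 + h₀), hDu⟩ : L2x L) = -(hDu.memLp_exprA₁.toLp _) := rfl
  rw [e, sub_neg_eq_add]
  refine Lp.ext ?_
  filter_upwards [Lp.coeFn_add (c • mu.toLp (w 0 + h₀)) (hDu.memLp_exprA₁.toLp _),
    Lp.coeFn_smul c (mu.toLp (w 0 + h₀)), hDu.memLp_exprA₁.coeFn_toLp, hcoe,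
    exprA₁_ae (t5.congr hcoe' .rfl) (t3.congr hcoe' .rfl)] with x a1 a2 a3 a4 a5
  rw [a1, Pi.add_apply, a2, Pi.smul_apply, a3, a4, a5]
  simp only [Pi.add_apply, Pi.smul_apply, smul_eq_mul]
  ring

end KawaharaWeighted

end

theorem mainTheorem5 (L : ℝ) (hL : 0 < L) :
    KawaharaWeighted.GeneratesC0Semigroup (-KawaharaWeighted.A₁ L) :=
  KawaharaWeighted.generatesC0Semigroup_of_quasidissipative
    (KawaharaWeighted.quasidissipative_neg_A₁ hL)
    fun _ hc f => KawaharaWeighted.exists_smul_sub_neg_A₁_eq hL hc f
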